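/- **Model.** Infinitely many clients and finitely many servers exchange messages (clients with servers, servers among each other) in an asynchronous system: every message is eventually received, exactly once and unmodified, after an arbitrary finite delay and in any order; every process is a deterministic state machine that takes local steps forever (a client only while it executes a transaction) and has no clock. In arbitrary executions, which the safety properties refer to, messages may also stay in transit; executions with the guarantees just listed are called fair. A storage is a finite non-empty set of objects, initialised to $\bot$; values come from an infinite set, and every value is written at most once. Each object is stored by at least one server, and no server stores all objects (in particular the objects may be partitioned among two or more servers each storing at least one object). A client may request any transaction $T=(R_T,W_T)$, which reads the objects of $R_T$ and writes values to the objects of $W_T$, both sets being arbitrary; it requests one transaction at a time, sends messages only while it executes a transaction, and eventually returns from every transaction in every fair execution. A server sends messages to a client only after having received one from that client. A client does not answer reads from its own memory; servers return one and only one value per object: for every $x\in R_T$, the messages that the client receives from a single server storing $x$ while it executes $T$ reveal (given the client's state when it started $T$) at most one value of $x$, all servers storing $x$ that reveal a value of $x$ reveal the same one, at least one does, and it is the value which the client returns for $x$. **Causal consistency.** For operations $\alpha,\beta$ (reads $r(x)v$, writes $w(x)v$) let $\alpha\rightsquigarrow\beta$ be the least transitive relation with $\alpha\rightsquigarrow\beta$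 if some client executes the transaction of $\alpha$ before that of $\beta$, or if $\alpha=w(x)v$ and $\beta=r(x)v$. The storage is causally consistent if at every point of every execution and for each client $C$, all transactions that contain a write and all transactions of $C$ can be totally ordered so that, for the reads of the ordered transactions, (1) for a read $r(x)v$ with $v\neq\bot$ the last write to $x$ preceding the transaction of the read writes $v$; (2) for a read $r(x)\bot$ no write to $x$ precedes its transaction; (3) if $\alpha\rightsquigarrow\beta$ then the transaction of $\alpha$ precedes that of $\beta$. **Progress.** In every fair execution, for every write $w=w(x)v$ there is a finite time $\tau$ such that every read of $x$ that starts at or after $\tau$ returns $v$, or a value $v'$ such that $w(x)v'$ returns no earlier than $w$ starts. **Fast transactions.** A transaction $T$ is fast if, whenever a client $C$ invokes $T$ and however messages are scheduled, the following holds, provided that the processes keep taking steps, that messages between $C$ and servers are eventually received, and that from the moment a server has received a message of this invocation from $C$ until the invocation ends, this server receives no message from any server and its messages to servers are delayed (messages not involving $C$ may be delayed arbitrarily): the invocation ends, and during it $C$ sends at most one message to each server, receives at most one message sent during the invocation from each server, and sends nothing once it has received such a message. **Theorem.** No implementation of a causally consistent storage in this model which guarantees progress provides fast read-only transactions, i.e.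 there is none in which every transaction with $W_T=\emptyset$ is fast. -/

import Mathlib

namespace CausalStorage

/-- A transaction: a read set, and a partial assignment of values to objects; its write set is the
domain of that assignment.  Either set may be empty. -/
structure Txn (Obj Val : Type*) where
  reads : Finset Obj
  writes : Obj → Option Val

/-- A transaction with an empty write set. -/
def Txn.ReadOnly {Obj Val : Type*} (T : Txn Obj Val) : Prop := ∀ x, T.writes x = none

/-- A message together with its sender and its destination. -/
structure Envelope (Client Server Msg : Type*) where
  src : Client ⊕ Server
  dst : Client ⊕ Server
  body : Msg

/-- What can trigger a step of a client: the request of a transaction, the reception of a message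
from a server, or nothing (a spontaneous local step). -/
inductive ClientInput (Obj Val Server Msg : Type*) where
  | start (T : Txn Obj Val)
  | recv (s : Server) (m : Msg)
  | tick

/-- An implementation of a storage: a deterministic state machine for every client and for every
server.  A step of a server is triggered by the reception of a message or by nothing (`none`), and
yields a new state and a list of messages to be sent.  A step of a client also says whether the
client returns from its current transaction, and with which values for the objects
(`none : Option Val` is the initial value `⊥`; only the values at the read set matter).
Processes have no access to a clock. -/
structure Protocol (Obj Val Client Server Msg SState CState : Type*) where
  serverInit : Server → SState
  clientInit : Client → CState
  serverStep : Server → SState → Option ((Client ⊕ Server) × Msg) →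
    SState × List ((Client ⊕ Server) × Msg)
  clientStep : Client → CState → ClientInput Obj Val Server Msg →
    CState × List (Server × Msg) × Option (Obj → Option Val)

/-- A global configuration.  `sent` lists all messages sent so far, so a message is identified by
its index in `sent`; `received` is the set of (indices of) messages already received. -/
structure Config (Obj Val Client Server Msg SState CState : Type*) where
  serverState : Server → SState
  clientState : Client → CState
  /-- the transaction which a client is currently executing, if any -/
  active : Client → Option (Txn Obj Val)
  sent : List (Envelope Client Server Msg)
  received : Set ℕ

/-- A scheduling decision: a client requests a transaction, the message of index `i` is received,
or a process takes a spontaneous local step. -/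
inductive Action (Obj Val Client Server : Type*) where
  | start (c : Client) (T : Txn Obj Val)
  | deliver (i : ℕ)
  | clientTick (c : Client)
  | serverTick (s : Server)

namespace Protocol

variable {Obj Val Client Server Msg SState CState : Type*}
  (A : Protocol Obj Val Client Server Msg SState CState)

/-- The initial configuration. -/
def initial : Config Obj Val Client Server Msg SState CState where
  serverState := A.serverInit
  clientState := A.clientInit
  active := fun _ => none
  sent := []
  received := ∅

open Classical in
/-- A step of server `s`. -/
noncomputable def serverMove (g : Config Obj Val Client Server Msg SState CState) (s : Server)
    (inp : Option ((Client ⊕ Server) × Msg)) : Config Obj Val Client Server Msg SState CState :=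
  let o := A.serverStep s (g.serverState s) inp
  { g with
    serverState := Function.update g.serverState s o.1
    sent := g.sent ++ o.2.map (fun p => ⟨Sum.inr s, p.1, p.2⟩) }

open Classical in
/-- A step of client `c`.  A client that executes no transaction (and receives a late message) only
updates its state: it sends nothing and returns nothing. -/
noncomputable def clientMove (g : Config Obj Val Client Server Msg SState CState) (c : Client)
    (inp : ClientInput Obj Val Server Msg) : Config Obj Val Client Server Msg SState CState :=
  let o := A.clientStep c (g.clientState c) inp
  if g.active c = none then
    { g with clientState := Function.update g.clientState c o.1 }
  else
    { g with
      clientState := Function.update g.clientState c o.1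
      active := if o.2.2.isSome then Function.update g.active c none else g.active
      sent := g.sent ++ o.2.1.map (fun p => ⟨Sum.inl c, Sum.inr p.1, p.2⟩) }

/-- Which actions are possible in a configuration.  Clients are sequential.  A message which has
been sent can be received at any later point, in any order, but only once. -/
def Enabled (g : Config Obj Val Client Server Msg SState CState) :
    Action Obj Val Client Server → Prop
  | .start c _ => g.active c = none
  | .deliver i => i < g.sent.length ∧ i ∉ g.received
  | .clientTick c => g.active c ≠ none
  | .serverTick _ => True

open Classical in
/-- The configuration after an action. -/
noncomputable def next (g : Config Obj Val Client Server Msg SState CState) :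
    Action Obj Val Client Server → Config Obj Val Client Server Msg SState CState
  | .start c T =>
      A.clientMove { g with active := Function.update g.active c (some T) } c (.start T)
  | .clientTick c => A.clientMove g c .tick
  | .serverTick s => A.serverMove g s none
  | .deliver i =>
      match g.sent[i]? with
      | some ⟨src, Sum.inr s, m⟩ =>
          A.serverMove { g with received := insert i g.received } s (some (src, m))
      | some ⟨Sum.inr s, Sum.inl c, m⟩ =>
          A.clientMove { g with received := insert i g.received } c (.recv s m)
      | _ => { g with received := insert i g.received }

/-- The client, if any, which takes a step in an action, with the trigger of that step. -/
def clientInput (g : Config Obj Val Client Server Msg SState CState) :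
    Action Obj Val Client Server → Option (Client × ClientInput Obj Val Server Msg)
  | .start c T => some (c, .start T)
  | .clientTick c => some (c, .tick)
  | .serverTick _ => none
  | .deliver i =>
      match g.sent[i]? with
      | some ⟨Sum.inr s, Sum.inl c, m⟩ => some (c, .recv s m)
      | _ => none

/-- An execution: an infinite sequence of steps from the initial configuration.  It need not be
fair.  Step `n` leads from configuration `n` to configuration `n + 1`; the index `n` plays the role
of the (global, inaccessible) time.  Every value is written at most once. -/
structure Execution where
  cfg : ℕ → Config Obj Val Client Server Msg SState CState
  act : ℕ → Action Obj Val Client Server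
  cfg_zero : cfg 0 = A.initial
  enabled : ∀ n, Enabled (cfg n) (act n)
  cfg_succ : ∀ n, cfg (n + 1) = A.next (cfg n) (act n)
  unique_writes : ∀ k c T x k' c' T' x' v, act k = .start c T → T.writes x = some v →
    act k' = .start c' T' → T'.writes x' = some v → k = k' ∧ x = x'

namespace Execution

variable {A} (E : A.Execution)

/-- Client `c` starts transaction `T` at step `n`.  A transaction instance (invocation) is
identified by the step at which it starts. -/
def Starts (n : ℕ) (c : Client) (T : Txn Obj Val) : Prop := E.act n = .start c T

/-- The invocation which `c` starts at step `n` is in progress during step `t` (this includes the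
step in which it starts and the step in which it ends). -/
def Running (n : ℕ) (c : Client) (t : ℕ) : Prop :=
  n ≤ t ∧ ∀ k, n < k → k ≤ t → (E.cfg k).active c ≠ none

/-- The invocation which `c` starts at step `n` ends at step `m`, returning `ρ`. -/
def Ends (n : ℕ) (c : Client) (m : ℕ) (ρ : Obj → Option Val) : Prop :=
  E.Running n c m ∧ ∃ inp, clientInput (E.cfg m) (E.act m) = some (c, inp) ∧
    (A.clientStep c ((E.cfg m).clientState c) inp).2.2 = some ρ

/-- At step `t`, process `q` receives message `m`, of index `i`, from process `p`. -/
def Receives (t i : ℕ) (p q : Client ⊕ Server) (m : Msg) : Prop :=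
  E.act t = .deliver i ∧ (E.cfg t).sent[i]? = some ⟨p, q, m⟩

/-- At step `t`, process `p` sends message `m`, of index `i`, to process `q`. -/
def Sends (t i : ℕ) (p q : Client ⊕ Server) (m : Msg) : Prop :=
  (E.cfg t).sent.length ≤ i ∧ (E.cfg (t + 1)).sent[i]? = some ⟨p, q, m⟩

/-! ### Causal consistency -/

end Execution

/-- Read or write. -/
inductive OpKind where
  | read
  | write

/-- An operation `r(x)v` or `w(x)v`, together with the transaction instance that contains it;
`val = none` stands for `⊥`. -/
structure Op (Obj Val : Type*) where
  tx : ℕ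
  kind : OpKind
  obj : Obj
  val : Option Val

namespace Execution

variable {A} (E : A.Execution)

/-- The operation `o` belongs to the history of the first `N` steps.  A write belongs to it as soon
as its transaction has started, a read once its transaction has ended. -/
def IsOp (N : ℕ) (o : Op Obj Val) : Prop :=
  match o.kind with
  | .write => o.tx < N ∧ ∃ c T v, E.Starts o.tx c T ∧ T.writes o.obj = some v ∧ o.val = some v
  | .read => ∃ c T m ρ, E.Starts o.tx c T ∧ E.Ends o.tx c m ρ ∧ m < N ∧
      o.obj ∈ T.reads ∧ o.val = ρ o.obj

/-- Causal precedence between operations of the history of the first `N` steps. -/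
inductive Causal (N : ℕ) : Op Obj Val → Op Obj Val → Prop
  | program {α β : Op Obj Val} (c : Client) (T T' : Txn Obj Val) :
      E.IsOp N α → E.IsOp N β → E.Starts α.tx c T → E.Starts β.tx c T' → α.tx < β.tx →
      Causal N α β
  | readsFrom {α β : Op Obj Val} :
      E.IsOp N α → E.IsOp N β → α.kind = .write → β.kind = .read → α.obj = β.obj →
      α.val = β.val → Causal N α β
  | trans {α γ β : Op Obj Val} : Causal N α γ → Causal N γ β → Causal N α β

/-- The transaction started at step `k < N` contains a write or is a transaction of client `i`. -/
def Ordered (N : ℕ) (i : Client) (k : ℕ) : Prop :=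
  k < N ∧ ∃ c T, E.Starts k c T ∧ (c = i ∨ ∃ x v, T.writes x = some v)

/-- The history of client `i` after the first `N` steps can be causally serialized.  The total
order on the (finitely many) transactions is given by an injective rank `pos`. -/
def CausallySerializable (N : ℕ) (i : Client) : Prop :=
  ∃ pos : ℕ → ℕ, Set.InjOn pos {k | E.Ordered N i k} ∧
    (∀ r v, E.IsOp N r → r.kind = .read → E.Ordered N i r.tx → r.val = some v →
      ∃ w, E.IsOp N w ∧ w.kind = .write ∧ w.obj = r.obj ∧ w.val = some v ∧ pos w.tx < pos r.tx ∧
        ∀ w', E.IsOp N w' → w'.kind = .write → w'.obj = r.obj → pos w'.tx < pos r.tx →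
          pos w'.tx ≤ pos w.tx) ∧
    (∀ r, E.IsOp N r → r.kind = .read → E.Ordered N i r.tx → r.val = none →
      ∀ w, E.IsOp N w → w.kind = .write → w.obj = r.obj → ¬ pos w.tx < pos r.tx) ∧
    (∀ α β, E.Causal N α β → E.Ordered N i α.tx → E.Ordered N i β.tx → pos α.tx < pos β.tx)

/-! ### Fairness -/

/-- An execution of the asynchronous system: every message sent is eventually received, every
server takes local steps forever, and so does every client while it executes a transaction. -/
def Fair : Prop :=
  (∀ n i, i < (E.cfg n).sent.length → ∃ t, E.act t = .deliver i) ∧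
  (∀ s n, ∃ t, n ≤ t ∧ E.act t = .serverTick s) ∧
  (∀ c n, ∃ t, n ≤ t ∧ (E.act t = .clientTick c ∨ (E.cfg t).active c = none))

/-! ### One version -/

open Classical in
/-- The messages which client `c` receives from server `s` in steps `n, …, m`, in order. -/
noncomputable def inbox (c : Client) (s : Server) (n m : ℕ) : List Msg :=
  (List.range' n (m + 1 - n)).filterMap fun t =>
    match E.act t with
    | .deliver i =>
        match (E.cfg t).sent[i]? with
        | some ⟨Sum.inr s', Sum.inl c', msg⟩ => if s' = s ∧ c' = c then some msg else none
        | _ => none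
    | _ => none

/-! ### Fast transactions -/

/-- At step `t`, server `s` receives a message which `c` sent in the invocation started at `n`. -/
def Contact (n : ℕ) (c : Client) (s : Server) (t : ℕ) : Prop :=
  n ≤ t ∧ ∃ i m, E.Receives t i (Sum.inl c) (Sum.inr s) m ∧ (E.cfg n).sent.length ≤ i

/-- Servers do not communicate for the sake of the invocation which `c` starts at step `n`: from
the moment a server has received a message of that invocation and until the invocation ends, the
server receives no message from any server, and any message it sends to a server is delayed. -/
def Isolated (n : ℕ) (c : Client) : Prop :=
  ∀ t i s s' m, E.Running n c t → E.Receives t i (Sum.inr s) (Sum.inr s') m →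
    (∀ t', E.Contact n c s' t' → ¬ t' < t) ∧
    (∀ t', E.Contact n c s t' → t' < t → i < (E.cfg t').sent.length)

/-- Client `c` and the servers keep taking steps, and the messages between `c` and the servers are
eventually received (other messages may be delayed for ever). -/
def FairTo (c : Client) : Prop :=
  (∀ n i s m, ((E.cfg n).sent[i]? = some ⟨Sum.inl c, Sum.inr s, m⟩ ∨
      (E.cfg n).sent[i]? = some ⟨Sum.inr s, Sum.inl c, m⟩) → ∃ t, E.act t = .deliver i) ∧
  (∀ s n, ∃ t, n ≤ t ∧ E.act t = .serverTick s) ∧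
  (∀ n, ∃ t, n ≤ t ∧ (E.act t = .clientTick c ∨ (E.cfg t).active c = none))

/-- The invocation which `c` starts at step `n` uses one communication round: `c` sends at most one
message to each server and receives at most one message from each server, and it sends nothing
once it has received such a message.  (Messages still in transit from earlier invocations of `c`
do not count.) -/
def OneRound (n : ℕ) (c : Client) : Prop :=
  (∀ s t t' i i' m m', E.Running n c t → E.Running n c t' →
    E.Sends t i (Sum.inl c) (Sum.inr s) m → E.Sends t' i' (Sum.inl c) (Sum.inr s) m' → i = i') ∧
  (∀ s t t' i i' m m', E.Running n c t → E.Running n c t' →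
    (E.cfg n).sent.length ≤ i → (E.cfg n).sent.length ≤ i' →
    E.Receives t i (Sum.inr s) (Sum.inl c) m → E.Receives t' i' (Sum.inr s) (Sum.inl c) m' →
    i = i') ∧
  (∀ s s' t t' i i' m m', E.Running n c t → E.Running n c t' → t ≤ t' →
    (E.cfg n).sent.length ≤ i → E.Receives t i (Sum.inr s) (Sum.inl c) m →
    ¬ E.Sends t' i' (Sum.inl c) (Sum.inr s') m')

end Execution

/-- Every transaction ends. -/
def TransactionsEnd : Prop :=
  ∀ E : A.Execution, E.Fair → ∀ n c T, E.Starts n c T → ∃ m ρ, E.Ends n c m ρ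

/-- Servers send messages to a client only if they have received a message from it before. -/
def ServersOnlyRespond : Prop :=
  ∀ (E : A.Execution) t i s c m, E.Sends t i (Sum.inr s) (Sum.inl c) m →
    ∃ t' i' m', t' ≤ t ∧ E.Receives t' i' (Sum.inl c) (Sum.inr s) m'

/-- Servers return one and only one value for each object that is read, and this is the value which
the client returns.  `reveal c σ T s l x` is the value of `x`, if any, that can be read off the
messages `l` which `c` receives from `s` while it executes `T`, having started `T` in the state
`σ`.  No messages reveal no value, so that a client never answers a read from its own memory. -/
def OneVersion (stores : Server → Set Obj) : Prop :=
  ∃ reveal : Client → CState → Txn Obj Val → Server → List Msg → Obj → Option (Option Val),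
    (∀ c σ T s x, reveal c σ T s [] x = none) ∧
    ∀ (E : A.Execution) n c T m ρ, E.Starts n c T → E.Ends n c m ρ → ∀ x ∈ T.reads,
      (∃ s, x ∈ stores s ∧
        reveal c ((E.cfg n).clientState c) T s (E.inbox c s n m) x = some (ρ x)) ∧
      (∀ s v, x ∈ stores s →
        reveal c ((E.cfg n).clientState c) T s (E.inbox c s n m) x = some v → v = ρ x)

/-- Causal consistency: at any point of any execution, each client's history can be causally
serialized. -/
def CausallyConsistent : Prop :=
  ∀ (E : A.Execution) N i, E.CausallySerializable N i

/-- Progress: for any write `w(x)v`, by a transaction started at step `k`, there is a time `τ` such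
that any read of `x` that starts at or after `τ` returns `v` or a value whose write returns no
earlier than step `k`. -/
def Progress : Prop :=
  ∀ E : A.Execution, E.Fair → ∀ k c T x v, E.Starts k c T → T.writes x = some v →
    ∃ τ, ∀ k' c' T' m ρ, τ ≤ k' → E.Starts k' c' T' → x ∈ T'.reads → E.Ends k' c' m ρ →
      ρ x = some v ∨
      ∃ u k₁ c₁ T₁, ρ x = some u ∧ E.Starts k₁ c₁ T₁ ∧ T₁.writes x = some u ∧
        ∀ m₁ ρ₁, E.Ends k₁ c₁ m₁ ρ₁ → k ≤ m₁

/-- Transaction `T` is fast: whenever it is invoked and however messages are scheduled, if servers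
do not communicate for its sake, then it ends, after one communication round. -/
def Fast (T : Txn Obj Val) : Prop :=
  ∀ (E : A.Execution) n c, E.Starts n c T → E.FairTo c → E.Isolated n c →
    (∃ m ρ, E.Ends n c m ρ) ∧ E.OneRound n c

/-- The implementation provides fast read-only transactions. -/
def FastReadOnly : Prop := ∀ T : Txn Obj Val, T.ReadOnly → A.Fast T

end Protocol

end CausalStorage

/-!
Call a read-only invocation *local* if, from its start on, nobody but a fresh client and the
servers takes part in the execution, and no server hears from another one. Suppose that only one
transaction `Tw` ever writes, and that it writes every object read by `T`. Then a local read of `T`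
returns `⊥` everywhere, at whatever step `n` it starts. The proof is by induction on `n`. The step
before the read changes the state of at most one server. Since that server does not store all
objects read, some object is revealed by another server, whose reply depends only on the state of
that server and on messages the client sends before it has received anything; so a local read which
starts one step earlier can obtain the same reply, and by induction the value revealed is `⊥`. By
causal consistency, one `⊥` excludes that the read sees `Tw` at all, so all values returned are `⊥`.

On the other hand, an execution which starts with `Tw` can be continued by infinitely many local
reads, each by a fresh client, with one step of a fair schedule between any two of them. The limit
is fair, because every reading client becomes inactive again, and it contradicts progress.
-/

namespace CausalStorage

theorem exists_recurrent_enumeration {α : Type*} {S : Set α} (hS : S.Countable)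
    (hne : S.Nonempty) : ∃ e : ℕ → α, ∀ a ∈ S, ∀ n, ∃ t ≥ n, e t = a := by
  obtain ⟨f, rfl⟩ := hS.exists_eq_range hne
  refine ⟨fun t => f t.unpair.1, ?_⟩
  rintro _ ⟨k, rfl⟩ n
  exact ⟨Nat.pair k n, Nat.right_le_pair k n, by simp⟩

theorem filterMap_eq_singleton {α β : Type*} {f : α → Option β} {l : List α} (hl : l.Nodup)
    {a : α} (ha : a ∈ l) {b : β} (hb : f a = some b) (h : ∀ a' ∈ l, f a' ≠ none → a' = a) :
    l.filterMap f = [b] := by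
  obtain ⟨l₁, l₂, rfl⟩ := List.append_of_mem ha
  have hnotMem : a ∉ l₁ ++ l₂ := (List.nodup_cons.1 (List.nodup_middle.1 hl)).1
  have hnil (l') (hl' : l' ⊆ l₁ ++ l₂) : l'.filterMap f = [] :=
    List.filterMap_eq_nil_iff.2 fun a' ha' => by_contra fun hne =>
      hnotMem (h a' (by have := hl' ha'; grind) hne ▸ hl' ha')
  rw [List.filterMap_append, List.filterMap_cons_some hb, hnil l₁ (List.subset_append_left ..),
    hnil l₂ (List.subset_append_right ..), List.nil_append]

end CausalStorage

namespace CausalStorage.Protocol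

open Set

variable {Obj Val Client Server Msg SState CState : Type*}
  {A : Protocol Obj Val Client Server Msg SState CState}

section Configurations

variable {g : Config Obj Val Client Server Msg SState CState} {a : Action Obj Val Client Server}

/-- The server, if any, which takes a step in an action, with the trigger of that step; the
counterpart of `clientInput`. -/
def serverInput (g : Config Obj Val Client Server Msg SState CState) :
    Action Obj Val Client Server → Option (Server × Option ((Client ⊕ Server) × Msg))
  | .serverTick s => some (s, none)
  | .deliver i =>
      match g.sent[i]? with
      | some ⟨p, Sum.inr s, m⟩ => some (s, some (p, m))
      | _ => none
  | _ => none

open Classical in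
/-- The configuration in which the process triggered by an action takes its step: a request or a
reception is already recorded, the states and the sent messages are still the old ones. -/
noncomputable def prepare (g : Config Obj Val Client Server Msg SState CState) :
    Action Obj Val Client Server → Config Obj Val Client Server Msg SState CState
  | .start c T => { g with active := Function.update g.active c (some T) }
  | .deliver i => { g with received := insert i g.received }
  | _ => g

/-- The message of index `i` has been sent, from `p` to `q`, but not yet received. -/
def Pending (g : Config Obj Val Client Server Msg SState CState) (i : ℕ) (p q : Client ⊕ Server)
    (m : Msg) : Prop :=
  g.sent[i]? = some ⟨p, q, m⟩ ∧ i ∉ g.received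

/-- Only messages which have been sent have been received. -/
def Consistent (g : Config Obj Val Client Server Msg SState CState) : Prop :=
  ∀ i ∈ g.received, i < g.sent.length

@[simp]
theorem prepare_serverState : (prepare g a).serverState = g.serverState := by cases a <;> rfl

@[simp]
theorem prepare_clientState : (prepare g a).clientState = g.clientState := by cases a <;> rfl

@[simp]
theorem prepare_sent : (prepare g a).sent = g.sent := by cases a <;> rfl

theorem mem_prepare_received {i : ℕ} :
    i ∈ (prepare g a).received ↔ i ∈ g.received ∨ a = .deliver i := by
  cases a <;> simp [prepare, or_comm, eq_comm]

theorem prepare_active_of_ne_start {c : Client} (h : ∀ T, a ≠ .start c T) :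
    (prepare g a).active c = g.active c := by
  cases a with
  | start c' T =>
    have hne : c ≠ c' := by rintro rfl; exact h T rfl
    simp [prepare, hne]
  | _ => rfl

theorem serverInput_eq_some {s : Server} {p : Client ⊕ Server} {m : Msg} :
    serverInput g a = some (s, some (p, m)) ↔
      ∃ i, a = .deliver i ∧ g.sent[i]? = some ⟨p, Sum.inr s, m⟩ := by
  cases a with
  | deliver i =>
    rcases hm : g.sent[i]? with _ | ⟨p' | p', q | q, m'⟩ <;> simp [serverInput, hm] <;> tauto
  | _ => simp [serverInput]

theorem clientInput_eq_start {c : Client} {T : Txn Obj Val} :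
    clientInput g a = some (c, .start T) ↔ a = .start c T := by
  cases a with
  | deliver i => rcases hm : g.sent[i]? with _ | ⟨p | p, q | q, m⟩ <;> simp [clientInput, hm]
  | _ => simp [clientInput]

theorem clientInput_eq_tick {c : Client} :
    clientInput g a = some (c, .tick) ↔ a = .clientTick c := by
  cases a with
  | deliver i => rcases hm : g.sent[i]? with _ | ⟨p | p, q | q, m⟩ <;> simp [clientInput, hm]
  | _ => simp [clientInput]

theorem clientInput_eq_recv {c : Client} {s : Server} {m : Msg} :
    clientInput g a = some (c, .recv s m) ↔
      ∃ i, a = .deliver i ∧ g.sent[i]? = some ⟨Sum.inr s, Sum.inl c, m⟩ := by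
  cases a with
  | deliver i =>
    rcases hm : g.sent[i]? with _ | ⟨p | p, q | q, m'⟩ <;> simp [clientInput, hm]
    tauto
  | _ => simp [clientInput]

/-- The third case is the reception of a message which one client sent to another: it triggers no
step. -/
theorem next_cases (A : Protocol Obj Val Client Server Msg SState CState)
    (g : Config Obj Val Client Server Msg SState CState) (a : Action Obj Val Client Server) :
    (∃ s inp, serverInput g a = some (s, inp) ∧ clientInput g a = none ∧
      A.next g a = A.serverMove (prepare g a) s inp) ∨
    (∃ c inp, serverInput g a = none ∧ clientInput g a = some (c, inp) ∧
      A.next g a = A.clientMove (prepare g a) c inp) ∨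
    (serverInput g a = none ∧ clientInput g a = none ∧ A.next g a = prepare g a) := by
  cases a with
  | deliver i =>
    rcases hm : g.sent[i]? with _ | ⟨p | p, q | q, m⟩ <;>
      simp [next, serverInput, clientInput, prepare, hm]
  | serverTick s => exact Or.inl ⟨s, none, rfl, rfl, rfl⟩
  | start c T => exact Or.inr (Or.inl ⟨c, .start T, rfl, rfl, rfl⟩)
  | clientTick c => exact Or.inr (Or.inl ⟨c, .tick, rfl, rfl, rfl⟩)

theorem next_of_serverInput {s : Server} {inp : Option ((Client ⊕ Server) × Msg)}
    (h : serverInput g a = some (s, inp)) :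
    A.next g a = A.serverMove (prepare g a) s inp := by
  rcases A.next_cases g a with ⟨s', inp', hs, -, hg⟩ | ⟨c, inp', hs, -, -⟩ | ⟨hs, -, -⟩ <;>
    simp_all

theorem next_of_clientInput {c : Client} {inp : ClientInput Obj Val Server Msg}
    (h : clientInput g a = some (c, inp)) :
    A.next g a = A.clientMove (prepare g a) c inp := by
  rcases A.next_cases g a with ⟨s, inp', -, hc, -⟩ | ⟨c', inp', -, hc, hg⟩ | ⟨-, hc, -⟩ <;>
    simp_all

theorem next_serverState_of_serverInput {s : Server} {inp : Option ((Client ⊕ Server) × Msg)}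
    (h : serverInput g a = some (s, inp)) :
    (A.next g a).serverState s = (A.serverStep s (g.serverState s) inp).1 := by
  simp [next_of_serverInput h, serverMove]

theorem next_serverState_of_ne {s : Server} (h : ∀ inp, serverInput g a ≠ some (s, inp)) :
    (A.next g a).serverState s = g.serverState s := by
  rcases A.next_cases g a with ⟨s', inp, hs, -, hg⟩ | ⟨c, inp, -, -, hg⟩ | ⟨-, -, hg⟩
  · have hne : s ≠ s' := by rintro rfl; exact h _ hs
    simp [hg, serverMove, hne]
  · rw [hg, clientMove]
    split <;> simp
  · simp [hg]

theorem next_clientState_of_clientInput {c : Client} {inp : ClientInput Obj Val Server Msg}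
    (h : clientInput g a = some (c, inp)) :
    (A.next g a).clientState c = (A.clientStep c (g.clientState c) inp).1 := by
  rw [next_of_clientInput h, clientMove]
  split <;> simp

theorem next_clientState_of_ne {c : Client} (h : ∀ inp, clientInput g a ≠ some (c, inp)) :
    (A.next g a).clientState c = g.clientState c := by
  rcases A.next_cases g a with ⟨s, inp, -, -, hg⟩ | ⟨c', inp, -, hc, hg⟩ | ⟨-, -, hg⟩
  · simp [hg, serverMove]
  · have hne : c ≠ c' := by rintro rfl; exact h _ hc
    rw [hg, clientMove]
    split <;> simp [hne]
  · simp [hg]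

theorem next_active_of_clientInput {c : Client} {inp : ClientInput Obj Val Server Msg}
    (h : clientInput g a = some (c, inp)) :
    (A.next g a).active c = if (A.clientStep c (g.clientState c) inp).2.2.isSome then none
      else (prepare g a).active c := by
  rw [next_of_clientInput h, clientMove, prepare_clientState]
  split_ifs <;> simp_all

theorem next_active_of_ne {c : Client} (h : ∀ inp, clientInput g a ≠ some (c, inp)) :
    (A.next g a).active c = g.active c := by
  have hstart (T) : a ≠ .start c T := fun ha => h _ (clientInput_eq_start.2 ha)
  rcases A.next_cases g a with ⟨s, inp, -, -, hg⟩ | ⟨c', inp, -, hc, hg⟩ | ⟨-, -, hg⟩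
  · simp [hg, serverMove, prepare_active_of_ne_start hstart]
  · have hne : c ≠ c' := by rintro rfl; exact h _ hc
    rw [hg, clientMove]
    split_ifs <;> simp [hne, prepare_active_of_ne_start hstart]
  · simp [hg, prepare_active_of_ne_start hstart]

theorem next_active_eq_none {c : Client} (hstart : ∀ T, a ≠ .start c T)
    (hg : g.active c = none) : (A.next g a).active c = none := by
  by_cases h : ∃ inp, clientInput g a = some (c, inp)
  · obtain ⟨inp, h⟩ := h
    simp [next_active_of_clientInput h, prepare_active_of_ne_start hstart, hg]
  · rw [next_active_of_ne (not_exists.1 h), hg]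

theorem next_serverState_of_clientInput {c : Client} {inp : ClientInput Obj Val Server Msg}
    (h : clientInput g a = some (c, inp)) : (A.next g a).serverState = g.serverState := by
  rw [next_of_clientInput h, clientMove]
  split <;> simp

theorem next_active_of_serverInput {s : Server} {inp : Option ((Client ⊕ Server) × Msg)}
    (h : serverInput g a = some (s, inp)) : (A.next g a).active = g.active := by
  rw [next_of_serverInput h]
  cases a with
  | start => cases h
  | _ => rfl

theorem next_sent_of_serverInput {s : Server} {inp : Option ((Client ⊕ Server) × Msg)}
    (h : serverInput g a = some (s, inp)) :
    (A.next g a).sent =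
      g.sent ++ (A.serverStep s (g.serverState s) inp).2.map fun p => ⟨.inr s, p.1, p.2⟩ := by
  simp [next_of_serverInput h, serverMove]

theorem next_sent_of_clientInput {c : Client} {inp : ClientInput Obj Val Server Msg}
    (h : clientInput g a = some (c, inp)) (hc : (prepare g a).active c ≠ none) :
    (A.next g a).sent = g.sent ++
      (A.clientStep c (g.clientState c) inp).2.1.map fun p => ⟨.inl c, .inr p.1, p.2⟩ := by
  simp [next_of_clientInput h, clientMove, hc]

theorem sent_prefix_next : g.sent <+: (A.next g a).sent := by
  rcases A.next_cases g a with ⟨s, inp, hs, -, -⟩ | ⟨c, inp, -, -, hg⟩ | ⟨-, -, hg⟩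
  · exact next_sent_of_serverInput hs ▸ List.prefix_append ..
  · rw [hg, clientMove]
    split <;> simp
  · simp [hg]

theorem next_received : (A.next g a).received = (prepare g a).received := by
  rcases A.next_cases g a with ⟨s, inp, -, -, hg⟩ | ⟨c, inp, -, -, hg⟩ | ⟨-, -, hg⟩
  · simp [hg, serverMove]
  · rw [hg, clientMove]
    split <;> rfl
  · rw [hg]

theorem mem_next_received {i : ℕ} :
    i ∈ (A.next g a).received ↔ i ∈ g.received ∨ a = .deliver i := by
  rw [next_received, mem_prepare_received]

theorem next_sent_cases {i : ℕ} {e : Envelope Client Server Msg}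
    (hi : g.sent.length ≤ i) (he : (A.next g a).sent[i]? = some e) :
    (∃ s inp, serverInput g a = some (s, inp) ∧ e.src = .inr s ∧
      (e.dst, e.body) ∈ (A.serverStep s (g.serverState s) inp).2) ∨
    (∃ c inp s, clientInput g a = some (c, inp) ∧ (prepare g a).active c ≠ none ∧
      e.src = .inl c ∧ e.dst = .inr s ∧
      (s, e.body) ∈ (A.clientStep c (g.clientState c) inp).2.1) := by
  have hold : g.sent[i]? = none := List.getElem?_eq_none hi
  rcases A.next_cases g a with ⟨s, inp, hs, -, -⟩ | ⟨c, inp, -, hc, hg⟩ | ⟨-, -, hg⟩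
  · rw [next_sent_of_serverInput hs, List.getElem?_append_right hi] at he
    obtain ⟨p, hp, rfl⟩ := List.mem_map.1 (List.mem_of_getElem? he)
    exact Or.inl ⟨s, inp, hs, rfl, hp⟩
  · by_cases hact : (prepare g a).active c = none
    · simp [hg, clientMove, hact, hold] at he
    · rw [next_sent_of_clientInput hc hact, List.getElem?_append_right hi] at he
      obtain ⟨p, hp, rfl⟩ := List.mem_map.1 (List.mem_of_getElem? he)
      exact Or.inr ⟨c, inp, p.1, hc, hact, rfl, rfl, hp⟩
  · simp [hg, hold] at he

theorem Consistent.next (hg : Consistent g) (ha : Enabled g a) : Consistent (A.next g a) := by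
  intro i hi
  refine lt_of_lt_of_le ?_ sent_prefix_next.length_le
  rcases mem_next_received.1 hi with hi | rfl
  · exact hg i hi
  · exact ha.1

theorem next_getElem?_sent {i : ℕ} {e : Envelope Client Server Msg} (h : g.sent[i]? = some e) :
    (A.next g a).sent[i]? = some e := by
  obtain ⟨l, hl⟩ := A.sent_prefix_next (g := g) (a := a)
  rw [← hl, List.getElem?_append_left (List.getElem?_eq_some_iff.1 h).1, h]

theorem Pending.next {i : ℕ} {p q : Client ⊕ Server} {m : Msg} (h : Pending g i p q m)
    (ha : a ≠ .deliver i) : Pending (A.next g a) i p q m :=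
  ⟨next_getElem?_sent h.1, fun hi => (mem_next_received.1 hi).elim h.2 ha⟩

theorem exists_pending_of_sent_eq_append (hg : Consistent g) (ha : Enabled g a)
    {l : List (Envelope Client Server Msg)} (hl : (A.next g a).sent = g.sent ++ l)
    {p q : Client ⊕ Server} {m : Msg} (hm : ⟨p, q, m⟩ ∈ l) :
    ∃ i, Pending (A.next g a) i p q m := by
  obtain ⟨k, hk⟩ := List.mem_iff_getElem?.1 hm
  refine ⟨g.sent.length + k, by simpa [hl, List.getElem?_append_right] using hk, fun hi => ?_⟩
  rcases mem_next_received.1 hi with hi | rfl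
  · exact absurd (hg _ hi) (by omega)
  · exact absurd ha.1 (by omega)

end Configurations

section Solo

variable {c : Client} {s : Server} {T : Txn Obj Val}
  {g g' : Config Obj Val Client Server Msg SState CState} {a : Action Obj Val Client Server}

/-- The actions of a configuration in which only `c` and the servers take part: no transaction is
requested, and all messages received are exchanged between `c` and a server. -/
def LocalTo (c : Client) (g : Config Obj Val Client Server Msg SState CState) :
    Action Obj Val Client Server → Prop
  | .start _ _ => False
  | .deliver i => ∃ s m, g.sent[i]? = some ⟨.inl c, .inr s, m⟩ ∨
      g.sent[i]? = some ⟨.inr s, .inl c, m⟩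
  | .clientTick c' => c' = c
  | .serverTick _ => True

theorem LocalTo.ne_start (h : LocalTo c g a) (c' : Client) (T : Txn Obj Val) :
    a ≠ .start c' T := by
  rintro rfl
  exact h

/-- A finite sequence of enabled actions leads from one configuration to another, and only `c` and
the servers take part in it. -/
def Path (A : Protocol Obj Val Client Server Msg SState CState) (c : Client) :
    (g g' : Config Obj Val Client Server Msg SState CState) → Prop :=
  Relation.ReflTransGen fun g g' => ∃ a, Enabled g a ∧ LocalTo c g a ∧ g' = A.next g a

theorem Path.tail (h : Path A c g g') (ha : Enabled g' a) (hl : LocalTo c g' a) :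
    Path A c g (A.next g' a) :=
  Relation.ReflTransGen.tail h ⟨a, ha, hl, rfl⟩

theorem Path.consistent (h : Path A c g g') (hg : Consistent g) : Consistent g' := by
  induction h with
  | refl => exact hg
  | tail _ h ih =>
    obtain ⟨a, ha, -, rfl⟩ := h
    exact ih.next ha

/-- The state of client `c` and the messages it has sent in its last step, in an invocation of `T`
with which `c` begins, as long as `c` has received no message and has not returned. -/
inductive Solo (A : Protocol Obj Val Client Server Msg SState CState) (c : Client)
    (T : Txn Obj Val) : CState → List (Server × Msg) → Prop
  | start {σ : CState} {l : List (Server × Msg)} :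
      A.clientStep c (A.clientInit c) (.start T) = (σ, l, none) → Solo A c T σ l
  | tick {σ σ' : CState} {l l' : List (Server × Msg)} :
      Solo A c T σ l → A.clientStep c σ .tick = (σ', l', none) → Solo A c T σ' l'

/-- The state of server `s` after a spontaneous local step in the state `x`. -/
def idle (A : Protocol Obj Val Client Server Msg SState CState) (s : Server) (x : SState) :
    SState :=
  (A.serverStep s x none).1

/-- A server `s` in the state `x` which takes local steps, except that it receives `b` from `c` at
some point, sends `m` to `c` at that point or later. -/
def Answers (A : Protocol Obj Val Client Server Msg SState CState) (c : Client) (s : Server)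
    (x : SState) (b m : Msg) : Prop :=
  ∃ j k, let o := A.serverStep s ((idle A s)^[j] x) (some (.inl c, b))
    (.inl c, m) ∈ o.2 ∨ (.inl c, m) ∈ (A.serverStep s ((idle A s)^[k] o.1) none).2

/-- A server `s` in the state `x` can send `m` in reply to `c`, which begins with an invocation of
`T`, without any other communication. This depends on no other part of a configuration. -/
def Reply (A : Protocol Obj Val Client Server Msg SState CState) (c : Client) (T : Txn Obj Val)
    (s : Server) (x : SState) (m : Msg) : Prop :=
  ∃ σ l b, Solo A c T σ l ∧ (s, b) ∈ l ∧ Answers A c s x b m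

theorem exists_pending_of_clientStep {inp : ClientInput Obj Val Server Msg}
    (hg : Consistent g) (ha : Enabled g a) (h : clientInput g a = some (c, inp))
    (hact : (prepare g a).active c ≠ none) {b : Msg}
    (hb : (s, b) ∈ (A.clientStep c (g.clientState c) inp).2.1) :
    ∃ i, Pending (A.next g a) i (.inl c) (.inr s) b :=
  exists_pending_of_sent_eq_append hg ha (next_sent_of_clientInput h hact)
    (List.mem_map.2 ⟨(s, b), hb, rfl⟩)

theorem exists_pending_of_serverStep {inp : Option ((Client ⊕ Server) × Msg)}
    (hg : Consistent g) (ha : Enabled g a) (h : serverInput g a = some (s, inp))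
    {q : Client ⊕ Server} {m : Msg} (hm : (q, m) ∈ (A.serverStep s (g.serverState s) inp).2) :
    ∃ i, Pending (A.next g a) i (.inr s) q m :=
  exists_pending_of_sent_eq_append hg ha (next_sent_of_serverInput h)
    (List.mem_map.2 ⟨(q, m), hm, rfl⟩)

theorem Solo.exists_path {σ : CState} {l : List (Server × Msg)} (h : Solo A c T σ l)
    (hg : Consistent g) (hact : g.active c = none) (hσ : g.clientState c = A.clientInit c) :
    ∃ g', Path A c (A.next g (.start c T)) g' ∧ g'.serverState = g.serverState ∧
      g'.clientState c = σ ∧ g'.active c ≠ none ∧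
      ∀ s b, (s, b) ∈ l → ∃ i, Pending g' i (.inl c) (.inr s) b := by
  induction h with
  | @start σ l hstep =>
    have hinp : clientInput g (.start c T) = some (c, .start T) := rfl
    have hen : Enabled g (.start c T) := hact
    rw [← hσ] at hstep
    refine ⟨_, .refl, next_serverState_of_clientInput hinp, ?_, ?_, fun s b hb =>
      exists_pending_of_clientStep hg hen hinp (by simp [prepare]) (by simpa [hstep] using hb)⟩
    · rw [next_clientState_of_clientInput hinp, hstep]
    · rw [next_active_of_clientInput hinp, hstep]
      simp [prepare]
  | @tick σ σ' l l' _ hstep ih =>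
    obtain ⟨g', hpath, hserver, rfl, hact', -⟩ := ih
    have hinp : clientInput g' (.clientTick c) = some (c, .tick) := rfl
    have hen : Enabled g' (.clientTick c) := hact'
    refine ⟨_, hpath.tail hen rfl, (next_serverState_of_clientInput hinp).trans hserver, ?_, ?_,
      fun s b hb => exists_pending_of_clientStep (hpath.consistent (hg.next hact)) hen hinp hact'
        (by simpa [hstep] using hb)⟩
    · rw [next_clientState_of_clientInput hinp, hstep]
    · rw [next_active_of_clientInput hinp, hstep]
      simpa [prepare] using hact'

theorem exists_path_idle (A : Protocol Obj Val Client Server Msg SState CState) (c : Client)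
    (s : Server) (g : Config Obj Val Client Server Msg SState CState) (k : ℕ) :
    ∃ g', Path A c g g' ∧ g'.serverState s = (idle A s)^[k] (g.serverState s) ∧
      g'.active = g.active ∧ ∀ i p q m, Pending g i p q m → Pending g' i p q m := by
  induction k with
  | zero => exact ⟨g, .refl, rfl, rfl, fun _ _ _ _ => id⟩
  | succ k ih =>
    obtain ⟨g', hpath, hstate, hact, hpend⟩ := ih
    have hinp : serverInput g' (.serverTick s) = some (s, none) := rfl
    refine ⟨_, hpath.tail (a := .serverTick s) trivial trivial, ?_,
      (next_active_of_serverInput hinp).trans hact, fun i p q m h => (hpend i p q m h).next nofun⟩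
    rw [next_serverState_of_serverInput hinp, hstate, Function.iterate_succ_apply', idle]

theorem Answers.exists_path {i : ℕ} {b m : Msg} (h : Answers A c s (g.serverState s) b m)
    (hg : Consistent g) (hi : Pending g i (.inl c) (.inr s) b) :
    ∃ g', Path A c g g' ∧ g'.active = g.active ∧ ∃ j, Pending g' j (.inr s) (.inl c) m := by
  obtain ⟨j, k, h⟩ := h
  obtain ⟨g₁, hpath₁, hstate₁, hact₁, hpend₁⟩ := exists_path_idle A c s g j
  have hi₁ := hpend₁ _ _ _ _ hi
  have hinp₁ : serverInput g₁ (.deliver i) = some (s, some (.inl c, b)) :=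
    serverInput_eq_some.2 ⟨i, rfl, hi₁.1⟩
  have hen₁ : Enabled g₁ (.deliver i) := ⟨(List.getElem?_eq_some_iff.1 hi₁.1).1, hi₁.2⟩
  have hpath₂ := hpath₁.tail hen₁ ⟨s, b, Or.inl hi₁.1⟩
  have hact₂ := (next_active_of_serverInput (A := A) hinp₁).trans hact₁
  rw [← hstate₁] at h
  rcases h with h | h
  · exact ⟨_, hpath₂, hact₂, exists_pending_of_serverStep (hpath₁.consistent hg) hen₁ hinp₁ h⟩
  · obtain ⟨g₃, hpath₃, hstate₃, hact₃, -⟩ := exists_path_idle A c s (A.next g₁ (.deliver i)) k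
    have hinp₃ : serverInput g₃ (.serverTick s) = some (s, none) := rfl
    have hen₃ : Enabled g₃ (.serverTick s) := trivial
    have hpath : Path A c g g₃ := hpath₂.trans hpath₃
    rw [next_serverState_of_serverInput hinp₁] at hstate₃
    rw [← hstate₃] at h
    exact ⟨_, hpath.tail hen₃ trivial,
      (next_active_of_serverInput hinp₃).trans (hact₃.trans hact₂),
      exists_pending_of_serverStep (hpath.consistent hg) hen₃ hinp₃ h⟩

theorem Reply.exists_path {m : Msg} (h : Reply A c T s (g.serverState s) m) (hg : Consistent g)
    (hact : g.active c = none) (hσ : g.clientState c = A.clientInit c) :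
    ∃ g', Path A c (A.next g (.start c T)) g' ∧ g'.active c ≠ none ∧
      ∃ j, Pending g' j (.inr s) (.inl c) m := by
  obtain ⟨σ, l, b, hsolo, hb, hans⟩ := h
  obtain ⟨g₁, hpath₁, hserver, -, hact₁, hpend⟩ := hsolo.exists_path hg hact hσ
  obtain ⟨i, hi⟩ := hpend s b hb
  rw [← hserver] at hans
  obtain ⟨g₂, hpath₂, hact₂, hm⟩ := hans.exists_path (hpath₁.consistent (hg.next hact)) hi
  exact ⟨g₂, hpath₁.trans hpath₂, hact₂ ▸ hact₁, hm⟩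

end Solo

namespace Execution

variable {E : A.Execution}

section Basic

variable {c : Client} {s : Server} {p q : Client ⊕ Server} {m : Msg} {i n t t' : ℕ}

theorem getElem?_sent_of_le {e : Envelope Client Server Msg} (h : t ≤ t')
    (he : (E.cfg t).sent[i]? = some e) : (E.cfg t').sent[i]? = some e := by
  induction t', h using Nat.le_induction with
  | base => exact he
  | succ t' _ ih => exact E.cfg_succ t' ▸ next_getElem?_sent ih

theorem getElem?_sent_eq {e : Envelope Client Server Msg} (he : (E.cfg t).sent[i]? = some e)
    (hi : i < (E.cfg t').sent.length) : (E.cfg t').sent[i]? = some e := by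
  obtain ⟨e', he'⟩ : ∃ e', (E.cfg t').sent[i]? = some e' := ⟨_, List.getElem?_eq_getElem hi⟩
  have h := getElem?_sent_of_le (le_max_left t t') he
  rwa [getElem?_sent_of_le (le_max_right t t') he', ← he'] at h

theorem exists_sends (h : (E.cfg t).sent[i]? = some ⟨p, q, m⟩) :
    ∃ t' < t, E.Sends t' i p q m := by
  induction t with
  | zero => simp [E.cfg_zero, initial] at h
  | succ t ih =>
    rcases lt_or_ge i (E.cfg t).sent.length with hi | hi
    · obtain ⟨t', ht', hs⟩ := ih (getElem?_sent_eq h hi)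
      exact ⟨t', ht'.trans t.lt_succ_self, hs⟩
    · exact ⟨t, t.lt_succ_self, hi, h⟩

theorem mem_received_iff : i ∈ (E.cfg t).received ↔ ∃ t' < t, E.act t' = .deliver i := by
  induction t with
  | zero => simp [E.cfg_zero, initial]
  | succ t ih =>
    simp only [E.cfg_succ, mem_next_received, ih, Nat.lt_succ_iff_lt_or_eq, or_and_right,
      exists_or, exists_eq_left]

theorem deliver_unique (h : E.act t = .deliver i) (h' : E.act t' = .deliver i) : t = t' := by
  wlog hlt : t < t' generalizing t t'
  · rcases (not_lt.1 hlt).lt_or_eq with hlt | rfl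
    exacts [(this h' h hlt).symm, rfl]
  have hen := E.enabled t'
  rw [h'] at hen
  exact absurd (mem_received_iff.2 ⟨t, hlt, h⟩) hen.2

theorem consistent_cfg (E : A.Execution) (t : ℕ) : Consistent (E.cfg t) := by
  induction t with
  | zero => simp [Consistent, E.cfg_zero, initial]
  | succ t ih => exact E.cfg_succ t ▸ ih.next (E.enabled t)

theorem Sends.of_client (h : E.Sends t i (.inl c) q m) :
    ∃ inp s, clientInput (E.cfg t) (E.act t) = some (c, inp) ∧ q = .inr s ∧
      (prepare (E.cfg t) (E.act t)).active c ≠ none ∧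
      (s, m) ∈ (A.clientStep c ((E.cfg t).clientState c) inp).2.1 := by
  obtain ⟨hi, h⟩ := h
  rw [E.cfg_succ] at h
  rcases next_sent_cases hi h with ⟨s, inp, -, hsrc, -⟩ | ⟨c', inp, s, hinp, hact, hsrc, rfl, hm⟩
  · cases hsrc
  · cases hsrc
    exact ⟨inp, s, hinp, rfl, hact, hm⟩

theorem Sends.of_server (h : E.Sends t i (.inr s) q m) :
    ∃ inp, serverInput (E.cfg t) (E.act t) = some (s, inp) ∧
      (q, m) ∈ (A.serverStep s ((E.cfg t).serverState s) inp).2 := by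
  obtain ⟨hi, h⟩ := h
  rw [E.cfg_succ] at h
  rcases next_sent_cases hi h with ⟨s', inp, hinp, hsrc, hm⟩ | ⟨c, inp, s', -, -, hsrc, -, -⟩
  · cases hsrc
    exact ⟨inp, hinp, hm⟩
  · cases hsrc

theorem Running.mono (h : E.Running n c t) (hn : n ≤ t') (ht : t' ≤ t) : E.Running n c t' :=
  ⟨hn, fun k hk hk' => h.2 k hk (hk'.trans ht)⟩

theorem Ends.active_eq_none {ρ : Obj → Option Val} (h : E.Ends n c t ρ) :
    (E.cfg (t + 1)).active c = none := by
  obtain ⟨-, inp, hinp, hρ⟩ := h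
  rw [E.cfg_succ, next_active_of_clientInput hinp, hρ]
  rfl

theorem Ends.le_of_running {ρ : Obj → Option Val} (h : E.Ends n c t ρ)
    (h' : E.Running n c t') : t' ≤ t := by
  by_contra! hlt
  exact h'.2 (t + 1) (Nat.lt_succ_of_le h.1.1) hlt h.active_eq_none

theorem return_eq_none {inp : ClientInput Obj Val Server Msg}
    (hinp : clientInput (E.cfg t) (E.act t) = some (c, inp))
    (hact : (E.cfg (t + 1)).active c ≠ none) :
    (A.clientStep c ((E.cfg t).clientState c) inp).2.2 = none := by
  rw [E.cfg_succ, next_active_of_clientInput hinp] at hact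
  split_ifs at hact with h
  · exact absurd rfl hact
  · exact Option.not_isSome_iff_eq_none.1 h

theorem active_eq_none_of_le (hstart : ∀ k, t ≤ k → k < t' → ∀ T, ¬ E.Starts k c T) (ht : t ≤ t')
    (h : (E.cfg t).active c = none) : (E.cfg t').active c = none := by
  induction t', ht using Nat.le_induction with
  | base => exact h
  | succ t' ht ih =>
    rw [E.cfg_succ]
    exact next_active_eq_none (hstart t' ht t'.lt_succ_self)
      (ih fun k hk hk' => hstart k hk (hk'.trans t'.lt_succ_self))

/-- Client `c` requests no transaction in the first `n` steps. -/
def Fresh (E : A.Execution) (n : ℕ) (c : Client) : Prop :=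
  ∀ k < n, ∀ T, ¬ E.Starts k c T

theorem Fresh.mono (h : E.Fresh n c) (ht : t ≤ n) : E.Fresh t c :=
  fun k hk => h k (hk.trans_le ht)

theorem Fresh.active_eq_none (h : E.Fresh n c) : (E.cfg n).active c = none :=
  active_eq_none_of_le (fun k _ hk => h k hk) n.zero_le (by simp [E.cfg_zero, initial])

theorem Fresh.not_sends (h : E.Fresh n c) (ht : t < n) : ¬ E.Sends t i (.inl c) q m := by
  intro hs
  obtain ⟨-, -, -, -, hact, -⟩ := hs.of_client
  rw [prepare_active_of_ne_start (h t ht)] at hact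
  exact hact (h.mono ht.le).active_eq_none

theorem Fresh.not_sent_by (h : E.Fresh n c) : (E.cfg n).sent[i]? ≠ some ⟨.inl c, q, m⟩ := by
  intro hi
  obtain ⟨t, ht, hs⟩ := exists_sends hi
  exact h.not_sends ht hs

theorem Fresh.not_sent_to (hrespond : A.ServersOnlyRespond) (h : E.Fresh n c) :
    (E.cfg n).sent[i]? ≠ some ⟨p, .inl c, m⟩ := by
  intro hi
  obtain ⟨t, ht, hs⟩ := exists_sends hi
  rcases p with c' | s
  · obtain ⟨_, _, _, hq, _⟩ := hs.of_client
    cases hq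
  · obtain ⟨t', i', m', ht', hr⟩ := hrespond E t i s c m hs
    exact (h.mono (ht'.trans ht.le)).not_sent_by hr.2

theorem Fresh.clientState_eq (hrespond : A.ServersOnlyRespond) (h : E.Fresh n c) :
    (E.cfg n).clientState c = A.clientInit c := by
  induction n with
  | zero => rw [E.cfg_zero, initial]
  | succ n ih =>
    have hn := h.mono n.le_succ
    rw [E.cfg_succ, next_clientState_of_ne, ih hn]
    intro inp hinp
    rcases inp with T | ⟨s, m⟩ | _
    · exact h n n.lt_succ_self T (clientInput_eq_start.1 hinp)
    · obtain ⟨i, -, hi⟩ := clientInput_eq_recv.1 hinp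
      exact hn.not_sent_to hrespond hi
    · have hen := E.enabled n
      rw [clientInput_eq_tick.1 hinp] at hen
      exact hen hn.active_eq_none

end Basic

section Extend

variable {E' E'' : A.Execution} {c : Client} {T : Txn Obj Val} {M N n t : ℕ}

/-- Two executions which coincide up to configuration `N`. -/
structure AgreeTo (N : ℕ) (E E' : A.Execution) : Prop where
  cfg_eq : ∀ t ≤ N, E'.cfg t = E.cfg t
  act_eq : ∀ t < N, E'.act t = E.act t

/-- The execution `E'` coincides with `E` up to configuration `N`, and the transactions which are
requested in `E'` but not in `E` are read-only. -/
structure Extends (N : ℕ) (E E' : A.Execution) : Prop extends AgreeTo N E E' where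
  readOnly_or_starts : ∀ t c T, E'.Starts t c T → T.ReadOnly ∨ E.Starts t c T

theorem AgreeTo.mono (h : AgreeTo N E E') (hM : M ≤ N) : AgreeTo M E E' :=
  ⟨fun t ht => h.cfg_eq t (ht.trans hM), fun t ht => h.act_eq t (ht.trans_le hM)⟩

theorem AgreeTo.trans (h : AgreeTo N E E') (h' : AgreeTo N E' E'') : AgreeTo N E E'' :=
  ⟨fun t ht => (h'.cfg_eq t ht).trans (h.cfg_eq t ht),
    fun t ht => (h'.act_eq t ht).trans (h.act_eq t ht)⟩

theorem AgreeTo.starts_iff (h : AgreeTo N E E') (ht : t < N) :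
    E'.Starts t c T ↔ E.Starts t c T := by
  rw [Starts, Starts, h.act_eq t ht]

theorem AgreeTo.ends (h : AgreeTo N E E') {m : ℕ} (hm : m < N) {ρ : Obj → Option Val}
    (hρ : E.Ends n c m ρ) : E'.Ends n c m ρ := by
  refine ⟨⟨hρ.1.1, fun k hk hk' => ?_⟩, ?_⟩
  · rw [h.cfg_eq k (hk'.trans hm.le)]
    exact hρ.1.2 k hk hk'
  · rw [h.cfg_eq m hm.le, h.act_eq m hm]
    exact hρ.2

theorem AgreeTo.fresh (h : AgreeTo N E E') (hc : E.Fresh N c) : E'.Fresh N c :=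
  fun k hk T hT => hc k hk T ((h.starts_iff hk).1 hT)

theorem AgreeTo.localTo (h : AgreeTo N E E') (ht : t < N)
    (hl : LocalTo c (E.cfg t) (E.act t)) : LocalTo c (E'.cfg t) (E'.act t) := by
  rwa [h.cfg_eq t ht.le, h.act_eq t ht]

theorem Extends.refl (N : ℕ) (E : A.Execution) : Extends N E E :=
  ⟨⟨fun _ _ => rfl, fun _ _ => rfl⟩, fun _ _ _ => Or.inr⟩

theorem Extends.trans (h : Extends N E E') (h' : Extends M E' E'') (hM : N ≤ M) :
    Extends N E E'' where
  toAgreeTo := h.toAgreeTo.trans (h'.toAgreeTo.mono hM)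
  readOnly_or_starts t c T hT :=
    (h'.readOnly_or_starts t c T hT).elim Or.inl (h.readOnly_or_starts t c T)

theorem exists_extends_of_schedule (E : A.Execution) (N : ℕ)
    (F : ℕ → Config Obj Val Client Server Msg SState CState → Action Obj Val Client Server)
    (henabled : ∀ t g, Enabled g (F t g))
    (hreadOnly : ∀ t g c T, F t g = .start c T → T.ReadOnly) :
    ∃ E', Extends N E E' ∧ ∀ t ≥ N, E'.act t = F t (E'.cfg t) := by
  let F' := fun t g => if t < N then E.act t else F t g
  let cfg : ℕ → Config Obj Val Client Server Msg SState CState :=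
    fun t => t.rec A.initial fun t g => A.next g (F' t g)
  have hact_lt {t} (ht : t < N) (g) : F' t g = E.act t := if_pos ht
  have hact_ge {t} (ht : N ≤ t) (g) : F' t g = F t g := if_neg ht.not_gt
  have hcfg (t) (ht : t ≤ N) : cfg t = E.cfg t := by
    induction t with
    | zero => exact E.cfg_zero.symm
    | succ t ih =>
      rw [E.cfg_succ, ← ih (t.le_succ.trans ht), ← hact_lt ht (cfg t)]
  have hstart {k c T} (hk : F' k (cfg k) = .start c T) : T.ReadOnly ∨ E.act k = .start c T := by
    rcases lt_or_ge k N with hN | hN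
    · exact Or.inr (hact_lt hN (cfg k) ▸ hk)
    · exact Or.inl (hreadOnly k _ c T (hact_ge hN (cfg k) ▸ hk))
  have hwrite {k c T x v} (hk : F' k (cfg k) = .start c T) (hv : T.writes x = some v) :
      E.act k = .start c T :=
    (hstart hk).resolve_left fun hT => by simp [hT x] at hv
  let E' : A.Execution :=
    { cfg := cfg
      act := fun t => F' t (cfg t)
      cfg_zero := rfl
      enabled := fun t => by
        rcases lt_or_ge t N with hN | hN
        · rw [hact_lt hN, hcfg t hN.le]
          exact E.enabled t
        · rw [hact_ge hN]
          exact henabled t _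
      cfg_succ := fun _ => rfl
      unique_writes := fun k c T x k' c' T' x' v hk hv hk' hv' =>
        E.unique_writes k c T x k' c' T' x' v (hwrite hk hv) hv (hwrite hk' hv') hv' }
  exact ⟨E', ⟨⟨hcfg, fun t ht => hact_lt ht _⟩, fun _ _ _ => hstart⟩, fun t ht => hact_ge ht _⟩

theorem exists_extends_act [Nonempty Server] {a : Action Obj Val Client Server}
    (ha : Enabled (E.cfg N) a) (hreadOnly : ∀ c T, a = .start c T → T.ReadOnly) :
    ∃ E', Extends N E E' ∧ E'.act N = a := by
  classical
  obtain ⟨s⟩ := ‹Nonempty Server›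
  obtain ⟨E', hE', hact⟩ := E.exists_extends_of_schedule N
    (fun _ g => if Enabled g a then a else .serverTick s)
    (fun _ g => by split_ifs with h; exacts [h, trivial])
    (fun _ g c T h => by split_ifs at h; exact hreadOnly c T h)
  exact ⟨E', hE', by rw [hact N le_rfl, if_pos (by rwa [hE'.cfg_eq N le_rfl])]⟩

theorem exists_extends_path [Nonempty Server]
    {g g' : Config Obj Val Client Server Msg SState CState} (h : Path A c g g')
    (hg : E.cfg N = g) :
    ∃ E' M, N ≤ M ∧ Extends N E E' ∧ E'.cfg M = g' ∧
      ∀ t, N ≤ t → t < M → LocalTo c (E'.cfg t) (E'.act t) := by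
  induction h with
  | refl => exact ⟨E, N, le_rfl, .refl N E, hg, fun t ht ht' => absurd ht ht'.not_ge⟩
  | @tail g₁ g₂ _ h ih =>
    obtain ⟨a, ha, hl, rfl⟩ := h
    obtain ⟨E₁, M, hM, hE₁, rfl, hlocal⟩ := ih
    obtain ⟨E₂, hE₂, hact⟩ := exists_extends_act ha fun c T h => (hl.ne_start c T h).elim
    refine ⟨E₂, M + 1, hM.trans M.le_succ, hE₁.trans hE₂ hM, ?_, fun t ht htM => ?_⟩
    · rw [E₂.cfg_succ, hact, hE₂.cfg_eq M le_rfl]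
    · rcases Nat.lt_succ_iff_lt_or_eq.1 htM with htM | rfl
      · rw [hE₂.cfg_eq t htM.le, hE₂.act_eq t htM]
        exact hlocal t ht htM
      · rwa [hact, hE₂.cfg_eq _ le_rfl]

/-- The actions which have to recur in order that an execution is fair to the servers and to `c`. -/
def tasks (c : Client) : Set (Action Obj Val Client Server) :=
  range .deliver ∪ range .serverTick ∪ {.clientTick c}

theorem exists_enumeration_tasks [Countable Server] (c : Client) :
    ∃ e : ℕ → Action Obj Val Client Server, ∀ a ∈ tasks c, ∀ n, ∃ t ≥ n, e t = a :=
  exists_recurrent_enumeration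
    (((countable_range _).union (countable_range _)).union (countable_singleton _))
    ⟨_, Or.inr rfl⟩

theorem fairTo_of_forall_tasks
    (h : ∀ a ∈ tasks c, ∀ n, ∃ t ≥ n,
      Enabled (E.cfg t) a → LocalTo c (E.cfg t) a → E.act t = a) : E.FairTo c := by
  refine ⟨fun n i s m hi => ?_, fun s n => ?_, fun n => ?_⟩
  · obtain ⟨t, ht, hact⟩ := h (.deliver i) (Or.inl (Or.inl ⟨i, rfl⟩)) n
    have hi' := hi.imp (getElem?_sent_of_le ht) (getElem?_sent_of_le ht)
    have hlt : i < (E.cfg t).sent.length := by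
      rcases hi' with hi' | hi' <;> exact (List.getElem?_eq_some_iff.1 hi').1
    by_cases hrec : i ∈ (E.cfg t).received
    · obtain ⟨t', -, ht'⟩ := mem_received_iff.1 hrec
      exact ⟨t', ht'⟩
    · exact ⟨t, hact ⟨hlt, hrec⟩ ⟨s, m, hi'⟩⟩
  · obtain ⟨t, ht, hact⟩ := h (.serverTick s) (Or.inl (Or.inr ⟨s, rfl⟩)) n
    exact ⟨t, ht, hact trivial trivial⟩
  · obtain ⟨t, ht, hact⟩ := h (.clientTick c) (Or.inr rfl) n
    exact ⟨t, ht, or_iff_not_imp_right.2 fun hc => hact hc rfl⟩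

theorem exists_extends_local [Nonempty Server] [Countable Server] (E : A.Execution) (N : ℕ)
    (c : Client) :
    ∃ E', Extends N E E' ∧ E'.FairTo c ∧ ∀ t ≥ N, LocalTo c (E'.cfg t) (E'.act t) := by
  classical
  obtain ⟨s⟩ := ‹Nonempty Server›
  obtain ⟨e, he⟩ := exists_enumeration_tasks (Obj := Obj) (Val := Val) (Server := Server) c
  obtain ⟨E', hE', hact⟩ := E.exists_extends_of_schedule N
    (fun t g => if Enabled g (e t) ∧ LocalTo c g (e t) then e t else .serverTick s)
    (fun _ g => by split_ifs with h; exacts [h.1, trivial])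
    (fun _ g c T h => by split_ifs at h with hl; exact (hl.2.ne_start c T h).elim)
  refine ⟨E', hE', fairTo_of_forall_tasks fun a ha n => ?_, fun t ht => ?_⟩
  · obtain ⟨t, ht, rfl⟩ := he a ha (max n N)
    exact ⟨t, (le_max_left n N).trans ht, fun hen hl =>
      (hact t ((le_max_right n N).trans ht)).trans (if_pos ⟨hen, hl⟩)⟩
  · rw [hact t ht]
    split_ifs with hl
    exacts [hl.2, trivial]

end Extend

section Inbox

variable {c : Client} {s : Server} {n m t i : ℕ} {msg : Msg}

theorem inbox_eq_filterMap (E : A.Execution) (c : Client) (s : Server) (n m : ℕ) :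
    ∃ f : ℕ → Option Msg, E.inbox c s n m = (List.range' n (m + 1 - n)).filterMap f ∧
      ∀ t msg, f t = some msg ↔ ∃ i, E.Receives t i (.inr s) (.inl c) msg := by
  classical
  refine ⟨_, rfl, fun t msg => ?_⟩
  rcases hact : E.act t with _ | i | _ | _
  case deliver =>
    rcases hm : (E.cfg t).sent[i]? with _ | ⟨p | p, q | q, m⟩ <;> simp [Receives, hact, hm]
    tauto
  all_goals simp [Receives, hact]

theorem exists_receives_of_inbox_ne_nil (h : E.inbox c s n m ≠ []) :
    ∃ t i msg, n ≤ t ∧ t ≤ m ∧ E.Receives t i (.inr s) (.inl c) msg := by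
  obtain ⟨f, hf, hrec⟩ := E.inbox_eq_filterMap c s n m
  rw [hf, ne_eq, List.filterMap_eq_nil_iff] at h
  push Not at h
  obtain ⟨t, ht, hne⟩ := h
  obtain ⟨msg, hmsg⟩ := Option.ne_none_iff_exists'.1 hne
  obtain ⟨i, hi⟩ := (hrec t msg).1 hmsg
  rw [List.mem_range'_1] at ht
  exact ⟨t, i, msg, ht.1, by omega, hi⟩

theorem inbox_eq_singleton_of_receives (hn : n ≤ t) (hm : t ≤ m)
    (hr : E.Receives t i (.inr s) (.inl c) msg)
    (hunique : ∀ t' i' msg', n ≤ t' → t' ≤ m → E.Receives t' i' (.inr s) (.inl c) msg' → i' = i) :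
    E.inbox c s n m = [msg] := by
  obtain ⟨f, hf, hrec⟩ := E.inbox_eq_filterMap c s n m
  rw [hf]
  refine filterMap_eq_singleton List.nodup_range' (List.mem_range'_1.2 ⟨hn, by omega⟩)
    ((hrec t msg).2 ⟨i, hr⟩) fun t' ht' hne => ?_
  obtain ⟨msg', hmsg'⟩ := Option.ne_none_iff_exists'.1 hne
  obtain ⟨i', hi'⟩ := (hrec t' msg').1 hmsg'
  rw [List.mem_range'_1] at ht'
  exact deliver_unique ((hunique t' i' msg' ht'.1 (by omega) hi') ▸ hi'.1) hr.1

end Inbox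

section LocalRead

variable {c : Client} {s : Server} {T : Txn Obj Val} {m : Msg} {i n t t' : ℕ}

/-- Client `c`, which has not requested any transaction before, requests `T` at step `n`, and from
then on only `c` and the servers take part in the execution, without messages between servers. -/
structure IsLocalRead (E : A.Execution) (n : ℕ) (c : Client) (T : Txn Obj Val) : Prop where
  fresh : E.Fresh n c
  starts : E.Starts n c T
  localTo : ∀ t > n, LocalTo c (E.cfg t) (E.act t)
  fairTo : E.FairTo c

theorem exists_isLocalRead_of_path [Nonempty Server] [Countable Server] (hT : T.ReadOnly)
    (hc : E.Fresh n c) {g : Config Obj Val Client Server Msg SState CState}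
    (hpath : Path A c (A.next (E.cfg n) (.start c T)) g) {a : Action Obj Val Client Server}
    (ha : Enabled g a) (hl : LocalTo c g a) :
    ∃ E' N, n < N ∧ Extends n E E' ∧ E'.IsLocalRead n c T ∧ E'.cfg N = g ∧ E'.act N = a := by
  obtain ⟨E₁, hE₁, hstart⟩ := E.exists_extends_act (a := .start c T) hc.active_eq_none
    (by rintro _ _ ⟨⟩; exact hT)
  obtain ⟨E₂, N, hN, hE₂, rfl, hlocal₂⟩ := exists_extends_path (N := n + 1) hpath
    (by rw [E₁.cfg_succ, hstart, hE₁.cfg_eq n le_rfl])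
  obtain ⟨E₃, hE₃, rfl⟩ := exists_extends_act ha fun c T h => (hl.ne_start c T h).elim
  obtain ⟨E₄, hE₄, hfair, hlocal₄⟩ := E₃.exists_extends_local (N + 1) c
  have h₁₄ : Extends (n + 1) E₁ E₄ := hE₂.trans (hE₃.trans hE₄ N.le_succ) hN
  have h₂₄ : Extends N E₂ E₄ := hE₃.trans hE₄ N.le_succ
  have h₀₄ : Extends n E E₄ := hE₁.trans h₁₄ n.le_succ
  refine ⟨E₄, N, hN, h₀₄, ⟨h₀₄.fresh hc, (h₁₄.starts_iff n.lt_succ_self).2 hstart,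
    fun t ht => ?_, hfair⟩, h₂₄.cfg_eq N le_rfl, hE₄.act_eq N N.lt_succ_self⟩
  rcases lt_trichotomy t N with htN | rfl | htN
  · exact h₂₄.localTo htN (hlocal₂ t ht htN)
  · exact hE₄.localTo t.lt_succ_self (by rwa [hE₃.cfg_eq t le_rfl])
  · exact hlocal₄ t htN

theorem exists_isLocalRead [Nonempty Server] [Countable Server] (hT : T.ReadOnly)
    (hc : E.Fresh n c) : ∃ E', Extends n E E' ∧ E'.IsLocalRead n c T := by
  obtain ⟨s⟩ := ‹Nonempty Server›
  obtain ⟨E', -, -, hE', hread, -⟩ :=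
    exists_isLocalRead_of_path hT hc .refl (a := .serverTick s) trivial trivial
  exact ⟨E', hE', hread⟩

namespace IsLocalRead

theorem not_starts (h : E.IsLocalRead n c T) (ht : n < t) {c' : Client} {T' : Txn Obj Val} :
    ¬ E.Starts t c' T' :=
  (h.localTo t ht).ne_start c' T'

theorem running (h : E.IsLocalRead n c T) (ht : n ≤ t) (hact : (E.cfg t).active c ≠ none) :
    E.Running n c t :=
  ⟨ht, fun _ hk hkt hnone => hact (active_eq_none_of_le
    (fun _ hk' _ _ => h.not_starts (hk.trans_le hk')) hkt hnone)⟩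

theorem lt_of_receives (h : E.IsLocalRead n c T) (ht : n ≤ t) {p q : Client ⊕ Server}
    (hr : E.Receives t i p q m) : n < t :=
  ht.lt_of_ne fun hnt => by cases (hnt ▸ h.starts : E.Starts t c T).symm.trans hr.1

theorem isolated (h : E.IsLocalRead n c T) : E.Isolated n c := by
  intro t i s s' m hrun hr
  have hl := h.localTo t (h.lt_of_receives hrun.1 hr)
  rw [hr.1] at hl
  obtain ⟨_, _, hi | hi⟩ := hl <;> cases hr.2.symm.trans hi

theorem receives_from (h : E.IsLocalRead n c T) (ht : n ≤ t) {p : Client ⊕ Server}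
    (hr : E.Receives t i p (.inr s) m) : p = .inl c := by
  have hl := h.localTo t (h.lt_of_receives ht hr)
  rw [hr.1] at hl
  obtain ⟨_, _, hi | hi⟩ := hl <;> cases hr.2.symm.trans hi
  rfl

theorem exists_sends_of_receives (h : E.IsLocalRead n c T)
    (hr : E.Receives t i (.inl c) (.inr s) m) :
    ∃ t', n ≤ t' ∧ t' < t ∧ E.Sends t' i (.inl c) (.inr s) m := by
  obtain ⟨t', ht', hs⟩ := exists_sends hr.2
  exact ⟨t', not_lt.1 fun hlt => h.fresh.not_sends hlt hs, ht', hs⟩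

theorem length_le_of_receives (hrespond : A.ServersOnlyRespond) (h : E.IsLocalRead n c T)
    (hr : E.Receives t i (.inr s) (.inl c) m) : (E.cfg n).sent.length ≤ i :=
  not_lt.1 fun hi => h.fresh.not_sent_to hrespond (getElem?_sent_eq hr.2 hi)

theorem eq_of_receives_request (h : E.IsLocalRead n c T) (hround : E.OneRound n c)
    {m' : Msg} {i' : ℕ} {N : ℕ} (hN : E.Running n c N) (ht : t ≤ N) (ht' : t' ≤ N)
    (hr : E.Receives t i (.inl c) (.inr s) m) (hr' : E.Receives t' i' (.inl c) (.inr s) m') :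
    t = t' := by
  obtain ⟨u, hu, hut, hs⟩ := h.exists_sends_of_receives hr
  obtain ⟨u', hu', hut', hs'⟩ := h.exists_sends_of_receives hr'
  obtain rfl := hround.1 s u u' i i' m m' (hN.mono hu (hut.le.trans ht))
    (hN.mono hu' (hut'.le.trans ht')) hs hs'
  exact deliver_unique hr.1 hr'.1

theorem exists_solo (hrespond : A.ServersOnlyRespond) (h : E.IsLocalRead n c T) (ht : n ≤ t)
    (hrun : E.Running n c (t + 1))
    (hno : ∀ t', n ≤ t' → t' ≤ t → ∀ i s m, ¬ E.Receives t' i (.inr s) (.inl c) m) :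
    ∃ l, Solo A c T ((E.cfg (t + 1)).clientState c) l ∧
      ∀ i s b, E.Sends t i (.inl c) (.inr s) b → (s, b) ∈ l := by
  induction t, ht using Nat.le_induction with
  | base =>
    have hinp := clientInput_eq_start (g := E.cfg n).2 h.starts
    have hret := return_eq_none hinp (hrun.2 (n + 1) n.lt_succ_self le_rfl)
    rw [E.cfg_succ, next_clientState_of_clientInput hinp]
    rw [h.fresh.clientState_eq hrespond] at hret ⊢
    refine ⟨_, .start (Prod.ext rfl (Prod.ext rfl hret)), fun i s b hs => ?_⟩
    obtain ⟨inp, s', hinp', hss, -, hb⟩ := hs.of_client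
    cases hinp.symm.trans hinp'
    cases hss
    rwa [h.fresh.clientState_eq hrespond] at hb
  | succ t ht ih =>
    obtain ⟨l, hsolo, -⟩ := ih (hrun.mono (by omega) (by omega)) fun t' hn ht' =>
      hno t' hn (by omega)
    by_cases hinp : clientInput (E.cfg (t + 1)) (E.act (t + 1)) = some (c, .tick)
    · have hret := return_eq_none hinp (hrun.2 (t + 2) (by omega) le_rfl)
      rw [E.cfg_succ (t + 1), next_clientState_of_clientInput hinp]
      refine ⟨_, hsolo.tick (Prod.ext rfl (Prod.ext rfl hret)), fun i s b hs => ?_⟩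
      obtain ⟨inp, s', hinp', hss, -, hb⟩ := hs.of_client
      cases hinp.symm.trans hinp'
      cases hss
      exact hb
    · have hne (inp) : clientInput (E.cfg (t + 1)) (E.act (t + 1)) ≠ some (c, inp) := by
        rintro hinp'
        rcases inp with T' | ⟨s, m⟩ | _
        · exact h.not_starts (Nat.lt_succ_of_le ht) (clientInput_eq_start.1 hinp')
        · obtain ⟨i, hi⟩ := clientInput_eq_recv.1 hinp'
          exact hno (t + 1) (by omega) le_rfl i s m hi
        · exact hinp hinp'
      refine ⟨l, by rwa [E.cfg_succ (t + 1), next_clientState_of_ne hne], fun i s b hs => ?_⟩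
      obtain ⟨inp, -, hinp', -⟩ := hs.of_client
      exact absurd hinp' (hne inp)

theorem exists_serverState_eq_iterate (h : E.IsLocalRead n c T) (hnt : n ≤ t) (ht : t ≤ t')
    (hno : ∀ u, t ≤ u → u < t' → ∀ i b, ¬ E.Receives u i (.inl c) (.inr s) b) :
    ∃ k, (E.cfg t').serverState s = (idle A s)^[k] ((E.cfg t).serverState s) := by
  induction t', ht using Nat.le_induction with
  | base => exact ⟨0, rfl⟩
  | succ t' ht ih =>
    obtain ⟨k, hk⟩ := ih fun u hu hu' => hno u hu (hu'.trans t'.lt_succ_self)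
    by_cases hinp : serverInput (E.cfg t') (E.act t') = some (s, none)
    · refine ⟨k + 1, ?_⟩
      rw [E.cfg_succ, next_serverState_of_serverInput hinp, hk, Function.iterate_succ_apply', idle]
    · refine ⟨k, (E.cfg_succ t' ▸ next_serverState_of_ne ?_ : _).trans hk⟩
      rintro (_ | ⟨p, b⟩) hinp'
      · exact hinp hinp'
      · obtain ⟨i, hi⟩ := serverInput_eq_some.1 hinp'
        obtain rfl := h.receives_from (hnt.trans ht) hi
        exact hno t' ht t'.lt_succ_self i b hi

theorem answers (h : E.IsLocalRead n c T) (hround : E.OneRound n c) (hrun : E.Running n c t')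
    {i' : ℕ} {b : Msg} (hn : n ≤ t) (ht : t ≤ t') (hr : E.Receives t i (.inl c) (.inr s) b)
    (hs : E.Sends t' i' (.inr s) (.inl c) m) :
    Answers A c s ((E.cfg n).serverState s) b m := by
  have hunique {u j b'} (hu : u ≤ t') (hr' : E.Receives u j (.inl c) (.inr s) b') : u = t :=
    h.eq_of_receives_request hround hrun hu ht hr' hr
  obtain ⟨inp, hinp, hm⟩ := hs.of_server
  have hinp₁ : serverInput (E.cfg t) (E.act t) = some (s, some (.inl c, b)) :=
    serverInput_eq_some.2 ⟨i, hr⟩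
  obtain ⟨j, hj⟩ := h.exists_serverState_eq_iterate le_rfl hn (s := s) fun u _ hu i b hr' =>
    hu.ne (hunique (hu.le.trans ht) hr')
  rcases ht.eq_or_lt with rfl | hlt
  · cases hinp.symm.trans hinp₁
    exact ⟨j, 0, Or.inl (hj ▸ hm)⟩
  · obtain ⟨k, hk⟩ := h.exists_serverState_eq_iterate (hn.trans t.le_succ) hlt (s := s)
      fun u hu hu' i b hr' => (Nat.lt_of_succ_le hu).ne' (hunique hu'.le hr')
    rw [E.cfg_succ t, next_serverState_of_serverInput hinp₁, hj] at hk
    obtain rfl : inp = none := by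
      rcases inp with _ | ⟨p, b'⟩
      · rfl
      obtain ⟨i, hi⟩ := serverInput_eq_some.1 hinp
      obtain rfl := h.receives_from hrun.1 hi
      exact absurd (hunique le_rfl hi) hlt.ne'
    exact ⟨j, k, Or.inr (hk ▸ hm)⟩

/-- By the one-round property, the request to which `s` answers was sent before `c` received
anything. -/
theorem reply_of_receives (hrespond : A.ServersOnlyRespond) (h : E.IsLocalRead n c T)
    (hround : E.OneRound n c) (hrun : E.Running n c t)
    (hr : E.Receives t i (.inr s) (.inl c) m) : Reply A c T s ((E.cfg n).serverState s) m := by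
  obtain ⟨t₃, ht₃, hs₃⟩ := exists_sends hr.2
  obtain ⟨t₂, i₂, b, ht₂, hr₂⟩ := hrespond E t₃ i s c m hs₃
  obtain ⟨t₁, hn, ht₁, hs₁⟩ := h.exists_sends_of_receives hr₂
  have hrun₁ : E.Running n c t₁ := hrun.mono hn (by omega)
  obtain ⟨l, hsolo, hl⟩ := h.exists_solo hrespond hn (hrun.mono (by omega) (by omega))
    fun t' hn' ht' i' s' m' hr' => hround.2.2 s' s t' t₁ i' i₂ m' b (hrun₁.mono hn' ht') hrun₁ ht'
      (h.length_le_of_receives hrespond hr') hr' hs₁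
  exact ⟨_, l, b, hsolo, hl i₂ s b hs₁,
    h.answers hround (hrun.mono (by omega) ht₃.le) (by omega) ht₂ hr₂ hs₃⟩

theorem inbox_eq_singleton (hrespond : A.ServersOnlyRespond) (h : E.IsLocalRead n c T)
    (hround : E.OneRound n c) {N : ℕ} (hN : E.Running n c N) (hn : n ≤ t) (ht : t ≤ N)
    (hr : E.Receives t i (.inr s) (.inl c) m) : E.inbox c s n N = [m] :=
  inbox_eq_singleton_of_receives hn ht hr fun t' i' m' hn' ht' hr' =>
    hround.2.1 s t' t i' i m' m (hN.mono hn' ht') (hN.mono hn ht)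
      (h.length_le_of_receives hrespond hr') (h.length_le_of_receives hrespond hr) hr' hr

end IsLocalRead

end LocalRead

section FastReads

variable {E' : A.Execution} {stores : Server → Set Obj} {T Tw : Txn Obj Val} {c : Client}
  {s : Server} {msg : Msg} {m n : ℕ} {ρ : Obj → Option Val} {x : Obj}

theorem IsLocalRead.exists_reply (hrespond : A.ServersOnlyRespond) (hone : A.OneVersion stores)
    (hfast : A.Fast T) (h : E.IsLocalRead n c T) (hend : E.Ends n c m ρ) (hx : x ∈ T.reads) :
    ∃ s msg, x ∈ stores s ∧ Reply A c T s ((E.cfg n).serverState s) msg ∧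
      ∀ {E' : A.Execution} {n' m' t i ρ'}, E'.IsLocalRead n' c T → E'.Ends n' c m' ρ' → n' ≤ t →
        t ≤ m' → E'.Receives t i (.inr s) (.inl c) msg → ρ' x = ρ x := by
  obtain ⟨reveal, hnil, hreveal⟩ := hone
  obtain ⟨⟨s, hs, hv⟩, -⟩ := hreveal E n c T m ρ h.starts hend x hx
  have hne : E.inbox c s n m ≠ [] := by
    intro hinbox
    rw [hinbox, hnil] at hv
    cases hv
  obtain ⟨t, i, msg, hnt, htm, hr⟩ := exists_receives_of_inbox_ne_nil hne
  have hround := (hfast E n c h.starts h.fairTo h.isolated).2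
  rw [h.inbox_eq_singleton hrespond hround hend.1 hnt htm hr,
    h.fresh.clientState_eq hrespond] at hv
  refine ⟨s, msg, hs, h.reply_of_receives hrespond hround (hend.1.mono hnt htm) hr,
    fun {E' n' m' t' i' ρ'} h' hend' hnt' htm' hr' => ?_⟩
  have hround' := (hfast E' n' c h'.starts h'.fairTo h'.isolated).2
  refine ((hreveal E' n' c T m' ρ' h'.starts hend' x hx).2 s (ρ x) hs ?_).symm
  rw [h'.inbox_eq_singleton hrespond hround' hend'.1 hnt' htm' hr',
    h'.fresh.clientState_eq hrespond, hv]

theorem exists_isLocalRead_of_reply [Nonempty Server] [Countable Server]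
    (hrespond : A.ServersOnlyRespond) (hT : T.ReadOnly) (hc : E.Fresh n c)
    (h : Reply A c T s ((E.cfg n).serverState s) msg) :
    ∃ E' N i, Extends n E E' ∧ E'.IsLocalRead n c T ∧ E'.Running n c N ∧
      E'.Receives N i (.inr s) (.inl c) msg := by
  obtain ⟨g, hpath, hact, i, hi⟩ := h.exists_path (E.consistent_cfg n) hc.active_eq_none
    (hc.clientState_eq hrespond)
  obtain ⟨E', N, hN, hE', hread, rfl, hdeliver⟩ := exists_isLocalRead_of_path hT hc hpath
    (a := .deliver i) ⟨(List.getElem?_eq_some_iff.1 hi.1).1, hi.2⟩ ⟨s, msg, Or.inr hi.1⟩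
  exact ⟨E', N, i, hE', hread, hread.running hN.le hact, hdeliver, hi.1⟩

theorem exists_server_forall_ne_serverState_eq [Nonempty Server] (E : A.Execution) (n : ℕ) :
    ∃ p, ∀ s ≠ p, (E.cfg (n + 1)).serverState s = (E.cfg n).serverState s := by
  by_cases h : ∃ p inp, serverInput (E.cfg n) (E.act n) = some (p, inp)
  · obtain ⟨p, inp, h⟩ := h
    refine ⟨p, fun s hs => E.cfg_succ n ▸ next_serverState_of_ne fun inp' h' => hs ?_⟩
    cases h.symm.trans h'
    rfl
  · push Not at h
    exact ⟨Classical.arbitrary Server, fun s _ =>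
      E.cfg_succ n ▸ next_serverState_of_ne fun inp => h s inp⟩

/-- Step `n` changes the state of at most one server, and an object of `T.reads` which that server
does not store is revealed by a reply that could as well have been obtained one step earlier. -/
theorem IsLocalRead.exists_earlier [Nonempty Server] [Countable Server]
    (hrespond : A.ServersOnlyRespond) (hone : A.OneVersion stores) (hfast : A.Fast T)
    (hT : T.ReadOnly) (hspan : ∀ s, ∃ x ∈ T.reads, x ∉ stores s)
    (h : E.IsLocalRead (n + 1) c T) (hend : E.Ends (n + 1) c m ρ) :
    ∃ E' m' ρ', Extends n E E' ∧ E'.IsLocalRead n c T ∧ E'.Ends n c m' ρ' ∧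
      ∃ x ∈ T.reads, ρ' x = ρ x := by
  obtain ⟨p, hp⟩ := E.exists_server_forall_ne_serverState_eq n
  obtain ⟨x, hx, hxp⟩ := hspan p
  obtain ⟨s, msg, hs, hreply, hvalue⟩ := h.exists_reply hrespond hone hfast hend hx
  rw [hp s (by rintro rfl; exact hxp hs)] at hreply
  obtain ⟨E', N, i, hE', hread, hrun, hr⟩ :=
    exists_isLocalRead_of_reply hrespond hT (h.fresh.mono n.le_succ) hreply
  obtain ⟨m', ρ', hend'⟩ := (hfast E' n c hread.starts hread.fairTo hread.isolated).1
  exact ⟨E', m', ρ', hE', hread, hend', x, hx,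
    hvalue hread hend' hrun.1 (hend'.le_of_running hrun) hr⟩

/-- All transactions requested in `E` are read-only, except that `Tw` may be requested in the very
first step. -/
def SingleWrite (Tw : Txn Obj Val) (E : A.Execution) : Prop :=
  ∀ k c T, E.Starts k c T → T.ReadOnly ∨ k = 0 ∧ T = Tw

theorem SingleWrite.extends (h : SingleWrite Tw E) (hE' : Extends n E E') : SingleWrite Tw E' :=
  fun k c T hT => (hE'.readOnly_or_starts k c T hT).elim Or.inl (h k c T)

theorem SingleWrite.starts_of_ne_none (hcausal : A.CausallyConsistent) (hE : SingleWrite Tw E)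
    (hstart : E.Starts n c T) (hend : E.Ends n c m ρ) (hx : x ∈ T.reads) (hρ : ρ x ≠ none) :
    (∃ c', E.Starts 0 c' Tw) ∧
      ∀ y ∈ T.reads, Tw.writes y ≠ none → ρ y ≠ none := by
  obtain ⟨pos, -, hsome, hnone, -⟩ := hcausal E (m + 1) c
  have hop (y) (hy : y ∈ T.reads) : E.IsOp (m + 1) ⟨n, .read, y, ρ y⟩ :=
    ⟨c, T, m, ρ, hstart, hend, m.lt_succ_self, hy, rfl⟩
  have hordered : E.Ordered (m + 1) c n := ⟨Nat.lt_succ_of_le hend.1.1, c, T, hstart, Or.inl rfl⟩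
  obtain ⟨v, hv⟩ := Option.ne_none_iff_exists'.1 hρ
  obtain ⟨⟨k, kind, z, u⟩, hw, rfl, -, -, hpos, -⟩ := hsome _ v (hop x hx) rfl hordered hv
  obtain ⟨-, c', Tw', v', hstart', hv', -⟩ := hw
  obtain ⟨rfl, rfl⟩ := (hE k c' Tw' hstart').resolve_left fun hro => by
    rw [hro] at hv'; cases hv'
  refine ⟨⟨c', hstart'⟩, fun y hy hwrites hnoney => ?_⟩
  obtain ⟨u, hu⟩ := Option.ne_none_iff_exists'.1 hwrites
  exact hnone _ (hop y hy) rfl hordered hnoney ⟨0, .write, y, some u⟩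
    ⟨m.succ_pos, c', Tw', u, hstart', hu, rfl⟩ rfl rfl hpos

theorem IsLocalRead.eq_none [Nonempty Server] [Countable Server]
    (hrespond : A.ServersOnlyRespond) (hone : A.OneVersion stores)
    (hcausal : A.CausallyConsistent) (hfast : A.Fast T) (hT : T.ReadOnly)
    (hspan : ∀ s, ∃ x ∈ T.reads, x ∉ stores s) (hTw : ∀ x ∈ T.reads, Tw.writes x ≠ none)
    (hE : SingleWrite Tw E) (h : E.IsLocalRead n c T) (hend : E.Ends n c m ρ)
    (hx : x ∈ T.reads) : ρ x = none := by
  induction n generalizing E m ρ x with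
  | zero =>
    by_contra hρ
    obtain ⟨⟨c', hstart⟩, -⟩ := hE.starts_of_ne_none hcausal h.starts hend hx hρ
    cases h.starts.symm.trans hstart
    exact hTw x hx (hT x)
  | succ n ih =>
    by_contra hρ
    obtain ⟨E', m', ρ', hE', hread, hend', y, hy, heq⟩ :=
      h.exists_earlier hrespond hone hfast hT hspan hend
    exact (hE.starts_of_ne_none hcausal h.starts hend hx hρ).2 y hy (hTw y hy)
      (heq ▸ ih (hE.extends hE') hread hend' hy)

/-- In an execution in which nothing but `Tw` is written, every local read of `T` ends and returns
`⊥` for all objects. -/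
def LocalReadsReturnBot (A : Protocol Obj Val Client Server Msg SState CState)
    (Tw T : Txn Obj Val) : Prop :=
  ∀ (E : A.Execution) n c, SingleWrite Tw E → E.IsLocalRead n c T →
    ∃ m ρ, E.Ends n c m ρ ∧ ∀ x ∈ T.reads, ρ x = none

theorem localReadsReturnBot [Nonempty Server] [Countable Server]
    (hrespond : A.ServersOnlyRespond) (hone : A.OneVersion stores)
    (hcausal : A.CausallyConsistent) (hfast : A.Fast T) (hT : T.ReadOnly)
    (hspan : ∀ s, ∃ x ∈ T.reads, x ∉ stores s) (hTw : ∀ x ∈ T.reads, Tw.writes x ≠ none) :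
    LocalReadsReturnBot A Tw T := by
  intro E n c hE h
  obtain ⟨m, ρ, hend⟩ := (hfast E n c h.starts h.fairTo h.isolated).1
  exact ⟨m, ρ, hend, fun x => h.eq_none hrespond hone hcausal hfast hT hspan hTw hE hend⟩

end FastReads

section Limit

variable {T Tw : Txn Obj Val} {cw : Client} {N : ℕ}

theorem exists_fresh [Infinite Client] (E : A.Execution) (n : ℕ) : ∃ c, E.Fresh n c := by
  have hfinite : {c | ∃ k < n, ∃ T, E.Starts k c T}.Finite := by
    have h (k) : {c | ∃ T, E.Starts k c T}.Subsingleton := by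
      rintro c ⟨T, hT⟩ c' ⟨T', hT'⟩
      cases hT.symm.trans hT'
      rfl
    exact ((finite_lt_nat n).biUnion fun k _ => (h k).finite).subset
      fun c ⟨k, hk, hT⟩ => mem_biUnion hk hT
  obtain ⟨c, hc⟩ := hfinite.exists_notMem
  exact ⟨c, fun k hk T hT => hc ⟨k, hk, T, hT⟩⟩

theorem exists_limit {E : ℕ → A.Execution} {N : ℕ → ℕ} (hN : StrictMono N)
    (h : ∀ j, AgreeTo (N j) (E j) (E (j + 1))) : ∃ L, ∀ j, AgreeTo (N j) (E j) L := by
  have hle {j k} (hjk : j ≤ k) : AgreeTo (N j) (E j) (E k) := by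
    induction k, hjk using Nat.le_induction with
    | base => exact (Extends.refl _ _).toAgreeTo
    | succ k hjk ih => exact ih.trans ((h k).mono (hN.monotone hjk))
  have hcfg {j k t} (hj : t ≤ N j) (hk : t ≤ N k) : (E j).cfg t = (E k).cfg t := by
    rcases le_total j k with hjk | hjk
    exacts [((hle hjk).cfg_eq t hj).symm, (hle hjk).cfg_eq t hk]
  have hact {j k t} (hj : t < N j) (hk : t < N k) : (E j).act t = (E k).act t := by
    rcases le_total j k with hjk | hjk
    exacts [((hle hjk).act_eq t hj).symm, (hle hjk).act_eq t hk]
  have hlt (t) : t < N (t + 1) := hN.le_apply (x := t + 1)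
  let L : A.Execution :=
    { cfg := fun t => (E (t + 1)).cfg t
      act := fun t => (E (t + 1)).act t
      cfg_zero := (E 1).cfg_zero
      enabled := fun t => (E (t + 1)).enabled t
      cfg_succ := fun t => by
        rw [← (E (t + 1)).cfg_succ]
        exact hcfg (hlt (t + 1)).le (hlt t)
      unique_writes := fun k c T x k' c' T' x' v hk hv hk' hv' => by
        have hmax := hlt (max k k')
        refine (E (max k k' + 1)).unique_writes k c T x k' c' T' x' v ?_ hv ?_ hv'
        · rwa [hact ((le_max_left k k').trans_lt hmax) (hlt k)]
        · rwa [hact ((le_max_right k k').trans_lt hmax) (hlt k')] }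
  exact ⟨L, fun j => ⟨fun t ht => hcfg (hlt t).le ht, fun t ht => hact (hlt t) ht⟩⟩

/-- A stage of the construction of a fair execution: `Tw`, requested by `cw` in the first step, is
the only write, and no other client is executing a transaction in configuration `N`. -/
structure IsStage (Tw : Txn Obj Val) (cw : Client) (E : A.Execution) (N : ℕ) : Prop where
  singleWrite : SingleWrite Tw E
  starts : E.Starts 0 cw Tw
  pos : 0 < N
  active_eq_none : ∀ c ≠ cw, (E.cfg N).active c = none

theorem exists_isStage [Nonempty Server] (A : Protocol Obj Val Client Server Msg SState CState)
    (cw : Client) (hTw : ∀ x y v, Tw.writes x = some v → Tw.writes y = some v → x = y) :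
    ∃ E : A.Execution, IsStage Tw cw E 1 := by
  obtain ⟨s⟩ := ‹Nonempty Server›
  let act : ℕ → Action Obj Val Client Server :=
    fun t => if t = 0 then .start cw Tw else .serverTick s
  have hact {k c T} (h : act k = .start c T) : k = 0 ∧ T = Tw := by
    simp only [act] at h
    split_ifs at h with hk
    cases h
    exact ⟨hk, rfl⟩
  let E : A.Execution :=
    { cfg := fun t => t.rec A.initial fun t g => A.next g (act t)
      act := act
      cfg_zero := rfl
      enabled := by rintro (_ | _); exacts [rfl, trivial]
      cfg_succ := fun _ => rfl
      unique_writes := fun k c T x k' c' T' x' v hk hv hk' hv' => by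
        obtain ⟨rfl, rfl⟩ := hact hk
        obtain ⟨rfl, rfl⟩ := hact hk'
        exact ⟨rfl, hTw x x' v hv hv'⟩ }
  have hfresh {c} (hc : c ≠ cw) : E.Fresh 1 c := by
    intro k hk T hT
    obtain rfl := Nat.lt_one_iff.1 hk
    cases hT
    exact hc rfl
  exact ⟨E, fun k c T hT => Or.inr (hact hT), rfl, one_pos, fun c hc => (hfresh hc).active_eq_none⟩

/-- The stage `E'`, `N'` continues the stage `E`, `N`: it performs the task `a`, if it can, and then
a complete read of `T` which returns `⊥` for all objects. -/
structure IsNextStage (T : Txn Obj Val) (cw : Client) (a : Action Obj Val Client Server)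
    (E : A.Execution) (N : ℕ) (E' : A.Execution) (N' : ℕ) : Prop where
  lt : N < N'
  agreeTo : AgreeTo N E E'
  act_eq : a ∈ tasks cw → Enabled (E.cfg N) a → E'.act N = a
  exists_read : ∃ n ≥ N, ∃ c, ∃ m < N', ∃ ρ, E'.Starts n c T ∧ E'.Ends n c m ρ ∧
    ∀ x ∈ T.reads, ρ x = none

theorem ne_start_of_mem_tasks {a : Action Obj Val Client Server} (ha : a ∈ tasks cw) (c : Client)
    (T : Txn Obj Val) : a ≠ .start c T := by
  rcases ha with (⟨i, rfl⟩ | ⟨s, rfl⟩) | rfl <;> exact nofun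

theorem exists_extends_task [Nonempty Server] (E : A.Execution) (N : ℕ)
    (a : Action Obj Val Client Server) :
    ∃ E', Extends N E E' ∧ (∀ c T, ¬ E'.Starts N c T) ∧
      (a ∈ tasks cw → Enabled (E.cfg N) a → E'.act N = a) := by
  by_cases ha : a ∈ tasks cw ∧ Enabled (E.cfg N) a
  · have hstart := ne_start_of_mem_tasks ha.1
    obtain ⟨E', hE', hact⟩ := exists_extends_act ha.2 fun c T h => (hstart c T h).elim
    exact ⟨E', hE', fun c T hT => hstart c T (hact.symm.trans hT), fun _ _ => hact⟩
  · obtain ⟨E', hE', hact⟩ := E.exists_extends_act (N := N)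
      (a := .serverTick (Classical.arbitrary Server)) trivial nofun
    exact ⟨E', hE', fun c T hT => (nomatch hact.symm.trans hT), fun h h' => (ha ⟨h, h'⟩).elim⟩

theorem IsStage.exists_isNextStage [Infinite Client] [Nonempty Server] [Countable Server]
    (hT : T.ReadOnly) (hread : LocalReadsReturnBot A Tw T) (h : IsStage Tw cw E N)
    (a : Action Obj Val Client Server) :
    ∃ E' N', IsStage Tw cw E' N' ∧ IsNextStage T cw a E N E' N' := by
  obtain ⟨E₁, hE₁, hstart₁, hact₁⟩ := E.exists_extends_task (cw := cw) N a
  obtain ⟨c, hc⟩ := E₁.exists_fresh (N + 1)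
  obtain ⟨E₂, hE₂, hlocal⟩ := exists_isLocalRead hT hc
  have hE : Extends N E E₂ := hE₁.trans hE₂ N.le_succ
  have hsingle := h.singleWrite.extends hE
  obtain ⟨m, ρ, hend, hρ⟩ := hread E₂ (N + 1) c hsingle hlocal
  have hNm : N + 1 ≤ m := hend.1.1
  refine ⟨E₂, m + 1, ⟨hsingle, (hE.starts_iff h.pos).2 h.starts, m.succ_pos, fun c' hc' => ?_⟩,
    ⟨by omega, hE.toAgreeTo, fun ha hen => (hE₂.act_eq N N.lt_succ_self).trans (hact₁ ha hen),
      N + 1, N.le_succ, c, m, m.lt_succ_self, ρ, hlocal.starts, hend, hρ⟩⟩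
  by_cases hcc : c' = c
  · exact hcc ▸ hend.active_eq_none
  refine active_eq_none_of_le (t := N) (fun k hk _ T' hT' => ?_) (by omega)
    (hE.cfg_eq N le_rfl ▸ h.active_eq_none c' hc')
  rcases lt_trichotomy k (N + 1) with hkN | rfl | hkN
  · obtain rfl : k = N := by omega
    exact hstart₁ c' T' ((hE₂.starts_iff k.lt_succ_self).1 hT')
  · cases hlocal.starts.symm.trans hT'
    exact hcc rfl
  · exact hlocal.not_starts hkN hT'

theorem exists_stages [Infinite Client] [Nonempty Server] [Countable Server]
    (hT : T.ReadOnly) (hread : LocalReadsReturnBot A Tw T)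
    (hTw : ∀ x y v, Tw.writes x = some v → Tw.writes y = some v → x = y) (cw : Client)
    (e : ℕ → Action Obj Val Client Server) :
    ∃ (E : ℕ → A.Execution) (N : ℕ → ℕ), ∀ j, IsStage Tw cw (E j) (N j) ∧
      IsNextStage T cw (e j) (E j) (N j) (E (j + 1)) (N (j + 1)) := by
  obtain ⟨E₀, hE₀⟩ := exists_isStage A cw hTw
  have hnext (j : ℕ) (p : {p : A.Execution × ℕ // IsStage Tw cw p.1 p.2}) :
      ∃ p' : {p : A.Execution × ℕ // IsStage Tw cw p.1 p.2},
        IsNextStage T cw (e j) p.1.1 p.1.2 p'.1.1 p'.1.2 := by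
    obtain ⟨E', N', hstage, hnext⟩ := p.2.exists_isNextStage hT hread (e j)
    exact ⟨⟨(E', N'), hstage⟩, hnext⟩
  choose next hnext using hnext
  let p : ℕ → {p : A.Execution × ℕ // IsStage Tw cw p.1 p.2} :=
    fun j => j.rec ⟨(E₀, 1), hE₀⟩ next
  exact ⟨fun j => (p j).1.1, fun j => (p j).1.2, fun j => ⟨(p j).2, hnext j (p j)⟩⟩

theorem fair_of_tasks {N : ℕ → ℕ} (hN : StrictMono N) {e : ℕ → Action Obj Val Client Server}
    (he : ∀ a ∈ tasks cw, ∀ n, ∃ t ≥ n, e t = a)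
    (hact : ∀ j, e j ∈ tasks cw → Enabled (E.cfg (N j)) (e j) → E.act (N j) = e j)
    (hinactive : ∀ j, ∀ c ≠ cw, (E.cfg (N j)).active c = none) : E.Fair := by
  have htask {a} (ha : a ∈ tasks cw) (n) : ∃ t ≥ n, Enabled (E.cfg t) a → E.act t = a := by
    obtain ⟨j, hj, rfl⟩ := he a ha n
    exact ⟨N j, hj.trans hN.le_apply, hact j ha⟩
  refine ⟨fun n i hi => ?_, fun s n => ?_, fun c n => ?_⟩
  · obtain ⟨t, ht, hdeliver⟩ := htask (a := .deliver i) (Or.inl (Or.inl ⟨i, rfl⟩)) n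
    by_cases hrec : i ∈ (E.cfg t).received
    · obtain ⟨t', -, ht'⟩ := mem_received_iff.1 hrec
      exact ⟨t', ht'⟩
    · have hlt := (List.getElem?_eq_some_iff.1
        (getElem?_sent_of_le ht (List.getElem?_eq_getElem hi))).1
      exact ⟨t, hdeliver ⟨hlt, hrec⟩⟩
  · obtain ⟨t, ht, htick⟩ := htask (a := .serverTick s) (Or.inl (Or.inr ⟨s, rfl⟩)) n
    exact ⟨t, ht, htick trivial⟩
  · by_cases hc : c = cw
    · subst hc
      obtain ⟨t, ht, htick⟩ := htask (a := .clientTick c) (Or.inr rfl) n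
      exact ⟨t, ht, or_iff_not_imp_right.2 htick⟩
    · exact ⟨N n, hN.le_apply, Or.inr (hinactive n c hc)⟩

theorem LocalReadsReturnBot.not_progress [Infinite Client] [Nonempty Server] [Countable Server]
    (hread : LocalReadsReturnBot A Tw T) (hT : T.ReadOnly)
    (hTw : ∀ x y v, Tw.writes x = some v → Tw.writes y = some v → x = y) {x : Obj}
    (hx : x ∈ T.reads) {v : Val} (hv : Tw.writes x = some v) : ¬ A.Progress := by
  intro hprogress
  have cw : Client := Classical.arbitrary Client
  obtain ⟨e, he⟩ := exists_enumeration_tasks (Obj := Obj) (Val := Val) (Server := Server) cw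
  obtain ⟨E, N, h⟩ := exists_stages hT hread hTw cw e
  have hN : StrictMono N := strictMono_nat_of_lt_succ fun j => (h j).2.lt
  obtain ⟨L, hL⟩ := exists_limit hN fun j => (h j).2.agreeTo
  have hfair : L.Fair := fair_of_tasks hN he
    (fun j ha hen => by
      rw [(hL (j + 1)).act_eq _ (hN j.lt_succ_self)]
      exact (h j).2.act_eq ha ((hL j).cfg_eq _ le_rfl ▸ hen))
    fun j c hc => (hL j).cfg_eq _ le_rfl ▸ (h j).1.active_eq_none c hc
  obtain ⟨τ, hτ⟩ := hprogress L hfair 0 cw Tw x v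
    (((hL 0).starts_iff (h 0).1.pos).2 (h 0).1.starts) hv
  obtain ⟨n, hn, c, m, hm, ρ, hstart, hend, hρ⟩ := (h τ).2.exists_read
  have hstart' : L.Starts n c T := ((hL (τ + 1)).starts_iff (hend.1.1.trans_lt hm)).2 hstart
  rcases hτ n c T m ρ (hN.le_apply.trans hn) hstart' hx ((hL (τ + 1)).ends hm hend) with
    hsome | ⟨u, -, -, -, hsome, -⟩ <;> cases (hρ x hx).symm.trans hsome

end Limit

end Execution

end CausalStorage.Protocol

theorem theorem1_general {Obj Val Client Server Msg SState CState : Type*}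
    [Infinite Val] [Infinite Client] [Nonempty Server] [Countable Server]
    (stores : Server → Set Obj)
    (A : CausalStorage.Protocol Obj Val Client Server Msg SState CState)
    (hrespond : A.ServersOnlyRespond)
    (hone : A.OneVersion stores)
    (hcausal : A.CausallyConsistent)
    (hprogress : A.Progress)
    (T : CausalStorage.Txn Obj Val) (hT : T.ReadOnly)
    (hspan : ∀ s, ∃ x ∈ T.reads, x ∉ stores s) :
    ¬ A.Fast T := by
  classical
  intro hfast
  let val : T.reads ↪ Val :=
    (T.reads.equivFin.toEmbedding.trans Fin.valEmbedding).trans (Infinite.natEmbedding Val)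
  let Tw : CausalStorage.Txn Obj Val :=
    ⟨∅, fun x => if hx : x ∈ T.reads then some (val ⟨x, hx⟩) else none⟩
  have hTw (x) (hx : x ∈ T.reads) : Tw.writes x = some (val ⟨x, hx⟩) := dif_pos hx
  have hinj (x y v) (hx : Tw.writes x = some v) (hy : Tw.writes y = some v) : x = y := by
    simp only [Tw, Option.dite_none_right_eq_some, Option.some.injEq] at hx hy
    obtain ⟨_, rfl⟩ := hx
    obtain ⟨_, hval⟩ := hy
    exact congrArg Subtype.val (val.injective hval).symm
  obtain ⟨x, hx, -⟩ := hspan (Classical.arbitrary Server)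
  have hread := CausalStorage.Protocol.Execution.localReadsReturnBot hrespond hone hcausal hfast
    hT hspan (Tw := Tw) fun x hx => by simp [hTw x hx]
  exact hread.not_progress hT hinj hx (hTw x hx) hprogress

theorem theorem1 {Obj Val Client Server Msg SState CState : Type*}
    [Finite Obj] [Nonempty Obj] [Infinite Val] [Infinite Client] [Finite Server]
    (stores : Server → Set Obj)
    (hstored : ∀ x, ∃ s, x ∈ stores s)
    (hpartial : ∀ s, ∃ x, x ∉ stores s)
    (A : CausalStorage.Protocol Obj Val Client Server Msg SState CState)
    (hend : A.TransactionsEnd)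
    (hrespond : A.ServersOnlyRespond)
    (hone : A.OneVersion stores)
    (hcausal : A.CausallyConsistent)
    (hprogress : A.Progress) :
    ¬ A.FastReadOnly := by
  have : Nonempty Server := (hstored (Classical.arbitrary Obj)).nonempty
  have := Fintype.ofFinite Obj
  exact fun hfast => theorem1_general stores A hrespond hone hcausal hprogress
    ⟨Finset.univ, fun _ => none⟩ (fun _ => rfl) (by simpa using hpartial) (hfast _ fun _ => rfl)
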